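/- Let $\Omega\subset\mathbb R^2$ be a bounded open region whose boundary $\partial\Omega$ is a simple closed piecewise $C^1$ curve, parametrized once around in the positive direction by $q(t)$, $t\in[0,1]$ (on each of finitely many closed pieces $q$ is $C^1$ with nonvanishing derivative). Let $A_\Omega$ be the area (Lebesgue measure) of $\Omega$ and $L$ the length of $\partial\Omega$. A planimeter of length $\ell>0$ tracing $\partial\Omega$ is a rod of length $\ell$ with tracer point $q$, angle $\theta$ and chisel point $p=q+\ell(\cos\theta,\sin\theta)$. Here $\theta$ is continuous on $[0,1]$ and, off finitely many times, $q$ and $\theta$ are differentiable and $N\cdot p'=0$, where $N=(\sin\theta,-\cos\theta)$ is the unit vector for which $(q-p,N)$ is positively oriented; the path of $p$ is called a tractrix. It is a closed tractrix with one full rotation if $p(1)=p(0)$ and $\theta(1)=\theta(0)+2\pi$. Put $$A_C=\tfrac12\int(p_x\,dp_y-p_y\,dp_x),\qquad \sigma_T=\int N\cdot dq,\qquad A_{\rm sw}=\int \ell\,N\cdot d\bigl(\tfrac{p+q}2\bigr)$$ (the oriented area enclosed by the path of $p$, the signed roll at the tracer point, and the oriented area swept out by the rod). Menzin's conjecture for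 $\Omega$ is the assertion that for every $\ell>0$ with $A_\Omega>\pi\ell^2$ there is a closed tractrix with one full rotation; Menzin's conjecture is this assertion for all $\Omega$ as above. 1. For every $\Omega$, every $\ell>0$ and every closed tractrix of $\partial\Omega$ with one full rotation, $$A_{\rm sw}=\pi\ell^2=A_\Omega-A_C=\ell\sigma_T-\pi\ell^2\qquad\text{and}\qquad \sigma_T\le L .$$ 2. If Menzin's conjecture holds for $\Omega$, then: (a) in the limiting case $A_\Omega=\pi\ell^2$, $\ell>0$, a closed tractrix with one full rotation still exists, and every such tractrix satisfies $A_C=0$ and $\sigma_T^2=4\pi A_\Omega$; (b) $L^2\ge 4\pi A_\Omega$; (c) if $L^2=4\pi A_\Omega$, then $\partial\Omega$ is a circle. 3. In particular, Menzin's conjecture implies the isoperimetric inequality: for every $\Omega$ as above $L^2\ge4\pi A_\Omega$, with equality only if $\partial\Omega$ is a circle. -/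

import Mathlib

open Set Filter Topology MeasureTheory

/-! The plane is `ℂ`, with its Euclidean norm, real inner product and Lebesgue measure.
Closed curves are parametrized by the interval `[0, 1]`. -/

namespace Planimeter

noncomputable section

/-- `γ : [0, 1] → ℂ` is piecewise `C¹`: the interval `[0, 1]` has a finite partition such that, on
each closed piece, `γ` is continuously differentiable up to the end points, with nonvanishing
(one-sided at the end points) derivative. In particular `γ` is continuous on `[0, 1]`; corners and
cusps are allowed. -/
def PiecewiseC1 (γ : ℝ → ℂ) : Prop :=
  ∃ (n : ℕ) (t : ℕ → ℝ), t 0 = 0 ∧ t n = 1 ∧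
    ∀ i < n, t i < t (i + 1) ∧
      ContDiffOn ℝ 1 γ (Icc (t i) (t (i + 1))) ∧
      ∀ s ∈ Icc (t i) (t (i + 1)), derivWithin γ (Icc (t i) (t (i + 1))) s ≠ 0

/-- `Ω` is a bounded open region of the plane whose boundary is the simple closed piecewise `C¹`
curve `γ`, traced once in the positive direction, that is, with `Ω` on the left of `γ`.
(By the Jordan curve theorem `Ω` is then the inside of `γ`, so it is simply connected.) -/
structure IsRegion (Ω : Set ℂ) (γ : ℝ → ℂ) : Prop where
  isOpen : IsOpen Ω
  isBounded : Bornology.IsBounded Ω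
  frontier_eq : frontier Ω = γ '' Icc 0 1
  closed : γ 0 = γ 1
  simple : InjOn γ (Ico 0 1)
  piecewiseC1 : PiecewiseC1 γ
  positive : ∀ s ∈ Ioo (0 : ℝ) 1, ∀ v : ℂ, HasDerivAt γ v s →
    ∀ᶠ ε : ℝ in 𝓝[>] 0, γ s + ε * (Complex.I * v) ∈ Ω

/-- The area of a plane region: its Lebesgue measure. -/
def area (Ω : Set ℂ) : ℝ := (volume Ω).toReal

/-- The length `∫ ds` of the curve `γ`. -/
def length (γ : ℝ → ℂ) : ℝ := ∫ t in (0 : ℝ)..1, ‖deriv γ t‖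

/-- The oriented area `½ ∮ (x dy - y dx)` enclosed by a closed curve (possibly with
self-intersections). -/
def orientedArea (c : ℝ → ℂ) : ℝ :=
  (1 / 2) * ∫ t in (0 : ℝ)..1, ((c t).re * (deriv c t).im - (c t).im * (deriv c t).re)

/-- The path of the chisel point: if the tracer point is at `γ t` and the rod has length `ℓ` and
angle `θ t`, then `chisel - tracer = ℓ (cos θ, sin θ)`. -/
def chisel (ℓ : ℝ) (γ : ℝ → ℂ) (θ : ℝ → ℝ) (t : ℝ) : ℂ :=
  γ t + ℓ * Complex.exp (θ t * Complex.I)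

/-- The unit normal `N` of the rod at angle `θ`: the rotation by `+π/2` of the direction
`- exp (i θ)` from the chisel point to the tracer point. -/
def rodNormal (θ : ℝ) : ℂ := Complex.I * (-Complex.exp (θ * Complex.I))

/-- `θ` is the angle function of a planimeter of length `ℓ` whose tracer point follows `γ`; the
chisel point then describes a tractrix of `γ`. The motion is continuous and, off finitely many
times, differentiable and subject to the nonholonomic constraint `dσ = N · dp = 0`: the velocity
of the chisel point `p` has no component normal to the rod. -/
def IsPlanimeterMotion (ℓ : ℝ) (γ : ℝ → ℂ) (θ : ℝ → ℝ) : Prop :=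
  ContinuousOn θ (Icc 0 1) ∧
    ∃ S : Finset ℝ, ∀ t ∈ Ioo (0 : ℝ) 1, t ∉ S →
      DifferentiableAt ℝ γ t ∧ DifferentiableAt ℝ θ t ∧
        inner ℝ (rodNormal (θ t)) (deriv (chisel ℓ γ θ) t) = 0

/-- The chisel point describes a closed tractrix of `γ` along which the planimeter makes one full
(counterclockwise) rotation. -/
def IsClosedTractrixOneRotation (ℓ : ℝ) (γ : ℝ → ℂ) (θ : ℝ → ℝ) : Prop :=
  IsPlanimeterMotion ℓ γ θ ∧
    chisel ℓ γ θ 0 = chisel ℓ γ θ 1 ∧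
    θ 1 - θ 0 = 2 * Real.pi

/-- The oriented area `∫ ℓ N · dm` swept out by the rod, with `m = (p + q) / 2` the midpoint of
the rod, `p` the chisel point and `q` the tracer point. -/
def sweptArea (ℓ : ℝ) (γ : ℝ → ℂ) (θ : ℝ → ℝ) : ℝ :=
  ∫ t in (0 : ℝ)..1,
    ℓ * inner ℝ (rodNormal (θ t)) (deriv (fun s => (chisel ℓ γ θ s + γ s) / 2) t)

/-- `σ_T = ∫ N · dq`, the total roll at the tracer point `q`. -/
def tracerRoll (γ : ℝ → ℂ) (θ : ℝ → ℝ) : ℝ :=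
  ∫ t in (0 : ℝ)..1, inner ℝ (rodNormal (θ t)) (deriv γ t)

/-- Menzin's conjecture for the single region `Ω` with boundary `γ`: every planimeter whose length
`ℓ` satisfies `area Ω > π ℓ²` has a closed tractrix with one full rotation. -/
def MenzinFor (Ω : Set ℂ) (γ : ℝ → ℂ) : Prop :=
  ∀ ℓ : ℝ, 0 < ℓ → Real.pi * ℓ ^ 2 < area Ω → ∃ θ : ℝ → ℝ, IsClosedTractrixOneRotation ℓ γ θ

/-- Menzin's conjecture, for all regions. -/
def MenzinConjecture : Prop :=
  ∀ (Ω : Set ℂ) (γ : ℝ → ℂ), IsRegion Ω γ → MenzinFor Ω γ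

end

end Planimeter

/-!
The tracer point `q` of a planimeter of length `ℓ` and its chisel point `p = q + ℓ e`,
`e = exp (i θ)`, satisfy `p' = q' - ℓ θ' N`, so the constraint `N · p' = 0` is the differential
equation `ℓ θ' = N · q'`. Integrated over one full rotation it gives `σ_T = 2 π ℓ`, and then
`A_sw = ℓ σ_T / 2 = π ℓ²` and `A_C = ½ ∮ q × dq - ℓ σ_T / 2` (`orientedArea_chisel_eq`). Together
with Green's formula `A_Ω = ½ ∮ q × dq` (`IsRegion.area_eq`) these are all the area identities, and
`σ_T ≤ L` because `N` is a unit vector.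

Green's formula has to be proved for a region of which only the boundary curve is known. Near a
smooth boundary point the map `(t, h) ↦ γ t + h v` is a chart whose Jacobian does not depend on
`h`; a change of variables and integration in `h` give `∫_Ω ∂_v φ` for test functions `φ` supported
there (`IsRegion.local_green_of_pos`). A priori `Ω` could lie on both sides of the curve, and then
the two contributions cancel; this is recorded by a weight on the boundary, `rightWeight`, which is
`0` or `1`. A partition of unity and cutoffs around the corners, whose gradients tend to `0` in
`L¹`, globalize the formula (`IsRegion.green`). Applied to divergence-free fields it says that the
weighted curve has no boundary, so that the weight cannot jump at a corner and is constant
(`IsRegion.exists_rightWeight_eq`). If it were `0`, then `Ω` would have area `0`. This replaces the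
Jordan curve theorem.

If `A_Ω = π ℓ²`, then Menzin's conjecture provides closed tractrices for rods of lengths
increasing to `ℓ`. By the differential equation their angle functions are uniformly Lipschitz, so by
the Arzelà–Ascoli theorem a subsequence converges, and the limit solves the integrated equation
(`exists_solvesPlanimeter_of_tendsto`). For this `ℓ` the estimate `L ≥ σ_T = 2 π ℓ` is the
isoperimetric inequality. In the case of equality `q' = |q'| N`, hence `p' = 0`: the chisel point
rests, and the tracer point runs through the circle of radius `ℓ` around it
(`SolvesPlanimeter.chisel_eq`, `image_eq_sphere`).
-/

namespace Planimeter

/-! ### Piecewise `C¹` curves -/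

/-- `γ` is continuous on `[0, 1]` and, off the finite set `S` of parameters, which contains the
end points, it is `C¹` with nonvanishing derivative of norm at most `C`. This is what the
arguments below use of a piecewise `C¹` curve. -/
structure IsTame (γ : ℝ → ℂ) (S : Finset ℝ) (C : ℝ) : Prop where
  continuousOn : ContinuousOn γ (Icc 0 1)
  zero_mem : 0 ∈ S
  one_mem : 1 ∈ S
  contDiffAt : ∀ s ∈ Ioo (0 : ℝ) 1, s ∉ S → ContDiffAt ℝ 1 γ s
  deriv_ne_zero : ∀ s ∈ Ioo (0 : ℝ) 1, s ∉ S → deriv γ s ≠ 0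
  norm_deriv_le : ∀ s ∈ Ioo (0 : ℝ) 1, s ∉ S → ‖deriv γ s‖ ≤ C

theorem PiecewiseC1.exists_isTame {γ : ℝ → ℂ} (h : PiecewiseC1 γ) :
    ∃ (S : Finset ℝ) (C : ℝ), IsTame γ S C := by
  obtain ⟨n, t, h0, h1, H⟩ := h
  have hcov : ∀ k ≤ n, t 0 ≤ t k ∧ ContinuousOn γ (Icc (t 0) (t k)) ∧
      ∀ s ∈ Ioc (t 0) (t k), ∃ i < k, s ∈ Ioc (t i) (t (i + 1)) := by
    intro k
    induction k with
    | zero => intro _; simp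
    | succ k ih =>
      intro hk
      obtain ⟨h01, hc, hs⟩ := ih (by omega)
      obtain ⟨hlt, hC, -⟩ := H k (by omega)
      refine ⟨h01.trans hlt.le, ?_, fun s hs' => ?_⟩
      · rw [← Icc_union_Icc_eq_Icc h01 hlt.le]
        exact hc.union_of_isClosed hC.continuousOn isClosed_Icc isClosed_Icc
      · rcases le_or_gt s (t k) with h | h
        · obtain ⟨i, hi, hsi⟩ := hs s ⟨hs'.1, h⟩
          exact ⟨i, by omega, hsi⟩
        · exact ⟨k, by omega, h, hs'.2⟩
  obtain ⟨-, hc, hs⟩ := hcov n le_rfl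
  rw [h0, h1] at hc hs
  have hbd : ∀ i, ∃ C, i < n → ∀ s ∈ Icc (t i) (t (i + 1)),
      ‖derivWithin γ (Icc (t i) (t (i + 1))) s‖ ≤ C := by
    intro i
    by_cases hi : i < n
    · obtain ⟨hlt, hC, -⟩ := H i hi
      obtain ⟨C, hC'⟩ := isCompact_Icc.exists_bound_of_continuousOn
        (hC.continuousOn_derivWithin (uniqueDiffOn_Icc hlt) le_rfl)
      exact ⟨C, fun _ => hC'⟩
    · exact ⟨0, fun h => absurd h hi⟩
  choose C hC using hbd
  have key : ∀ s ∈ Ioo (0 : ℝ) 1, s ∉ (Finset.range (n + 1)).image t →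
      ∃ i < n, s ∈ Ioo (t i) (t (i + 1)) := by
    intro s hs1 hS
    obtain ⟨i, hi, hsi⟩ := hs s ⟨hs1.1, hs1.2.le⟩
    refine ⟨i, hi, hsi.1, lt_of_le_of_ne hsi.2 ?_⟩
    rintro rfl
    exact hS (Finset.mem_image_of_mem _ (Finset.mem_range.2 (by omega)))
  refine ⟨(Finset.range (n + 1)).image t, ∑ i ∈ Finset.range n, |C i|, hc,
    Finset.mem_image.2 ⟨0, by simp, h0⟩, Finset.mem_image.2 ⟨n, by simp, h1⟩, ?_, ?_, ?_⟩
  · intro s hs1 hS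
    obtain ⟨i, hi, hsi⟩ := key s hs1 hS
    exact (H i hi).2.1.contDiffAt (Icc_mem_nhds hsi.1 hsi.2)
  · intro s hs1 hS
    obtain ⟨i, hi, hsi⟩ := key s hs1 hS
    have := (H i hi).2.2 s ⟨hsi.1.le, hsi.2.le⟩
    rwa [derivWithin_of_mem_nhds (Icc_mem_nhds hsi.1 hsi.2)] at this
  · intro s hs1 hS
    obtain ⟨i, hi, hsi⟩ := key s hs1 hS
    have := hC i hi s ⟨hsi.1.le, hsi.2.le⟩
    rw [derivWithin_of_mem_nhds (Icc_mem_nhds hsi.1 hsi.2)] at this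
    exact this.trans ((le_abs_self _).trans
      (Finset.single_le_sum (f := fun i => |C i|) (fun _ _ => abs_nonneg _)
        (Finset.mem_range.2 hi)))

theorem ae_restrict_uIoc_of_finset {p : ℝ → Prop} {a b : ℝ} (hab : a ≤ b) (S : Finset ℝ)
    (h : ∀ t ∈ Ioo a b, t ∉ S → p t) :
    ∀ᵐ t ∂(volume.restrict (uIoc a b)), p t := by
  rw [uIoc_of_le hab, ae_restrict_iff' measurableSet_Ioc]
  have h1 : ∀ᵐ t : ℝ, t ∉ ((S : Set ℝ) ∪ {b}) :=
    measure_eq_zero_iff_ae_notMem.1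
      ((S.finite_toSet.union (finite_singleton b)).measure_zero volume)
  filter_upwards [h1] with t ht ht'
  simp only [mem_union, Finset.mem_coe, mem_singleton_iff, not_or] at ht
  exact h t ⟨ht'.1, lt_of_le_of_ne ht'.2 ht.2⟩ ht.1

theorem intervalIntegral_congr_of_finset {E : Type*} [NormedAddCommGroup E] [NormedSpace ℝ E]
    {f g : ℝ → E} {a b : ℝ} (hab : a ≤ b) (S : Finset ℝ)
    (h : ∀ t ∈ Ioo a b, t ∉ S → f t = g t) :
    ∫ t in a..b, f t = ∫ t in a..b, g t := by
  apply intervalIntegral.integral_congr_ae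
  have := ae_restrict_uIoc_of_finset hab S h
  rwa [ae_restrict_iff' measurableSet_uIoc] at this

theorem intervalIntegrable_of_finset {E : Type*} [NormedAddCommGroup E] {f : ℝ → E}
    (S : Finset ℝ) (C : ℝ)
    (hm : AEStronglyMeasurable f (volume.restrict (uIoc (0 : ℝ) 1)))
    (h : ∀ t ∈ Ioo (0 : ℝ) 1, t ∉ S → ‖f t‖ ≤ C) :
    IntervalIntegrable f volume 0 1 := by
  rw [intervalIntegrable_iff]
  have : IsFiniteMeasure (volume.restrict (uIoc (0 : ℝ) 1)) := ⟨by simp [uIoc]⟩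
  exact Integrable.of_bound hm C (ae_restrict_uIoc_of_finset zero_le_one S h)

theorem aestronglyMeasurable_uIoc_of_continuousOn {E : Type*} [NormedAddCommGroup E]
    {f : ℝ → E} (hf : ContinuousOn f (Icc 0 1)) :
    AEStronglyMeasurable f (volume.restrict (uIoc (0 : ℝ) 1)) := by
  rw [uIoc_of_le zero_le_one]
  exact (hf.mono Ioc_subset_Icc_self).aestronglyMeasurable measurableSet_Ioc

theorem aestronglyMeasurable_deriv_uIoc (γ : ℝ → ℂ) :
    AEStronglyMeasurable (deriv γ) (volume.restrict (uIoc (0 : ℝ) 1)) :=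
  (stronglyMeasurable_deriv γ).aestronglyMeasurable

namespace IsTame

variable {γ : ℝ → ℂ} {S : Finset ℝ} {C : ℝ}

theorem differentiableAt (h : IsTame γ S C) {s : ℝ} (hs : s ∈ Ioo (0 : ℝ) 1) (hS : s ∉ S) :
    DifferentiableAt ℝ γ s :=
  (h.contDiffAt s hs hS).differentiableAt one_ne_zero

theorem hasDerivAt (h : IsTame γ S C) {s : ℝ} (hs : s ∈ Ioo (0 : ℝ) 1) (hS : s ∉ S) :
    HasDerivAt γ (deriv γ s) s :=
  (h.differentiableAt hs hS).hasDerivAt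

theorem intervalIntegrable_deriv (h : IsTame γ S C) : IntervalIntegrable (deriv γ) volume 0 1 :=
  intervalIntegrable_of_finset S C (aestronglyMeasurable_deriv_uIoc γ) h.norm_deriv_le

theorem intervalIntegrable_inner (h : IsTame γ S C) {u : ℝ → ℂ} (hu : ContinuousOn u (Icc 0 1)) :
    IntervalIntegrable (fun t => inner ℝ (u t) (deriv γ t)) volume 0 1 := by
  obtain ⟨M, hM⟩ := isCompact_Icc.exists_bound_of_continuousOn hu
  refine intervalIntegrable_of_finset S (M * C)
    ((aestronglyMeasurable_uIoc_of_continuousOn hu).inner (aestronglyMeasurable_deriv_uIoc γ)) ?_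
  intro t ht hS
  refine (norm_inner_le_norm _ _).trans ?_
  have := hM t ⟨ht.1.le, ht.2.le⟩
  exact mul_le_mul this (h.norm_deriv_le t ht hS) (norm_nonneg _) ((norm_nonneg _).trans this)

end IsTame

theorem integral_eq_sub_of_finset {E : Type*} [NormedAddCommGroup E] [NormedSpace ℝ E]
    [CompleteSpace E] {f f' : ℝ → E} (S : Finset ℝ) (hc : ContinuousOn f (Icc 0 1))
    (hd : ∀ t ∈ Ioo (0 : ℝ) 1, t ∉ S → HasDerivAt f (f' t) t)
    (hi : IntervalIntegrable f' volume 0 1) : ∫ t in (0 : ℝ)..1, f' t = f 1 - f 0 :=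
  integral_eq_of_hasDerivAt_off_countable_of_le f f' zero_le_one S.countable_toSet hc
    (fun t ht => hd t ht.1 ht.2) hi

/-! ### Kinematics of the planimeter -/

theorem inner_rodNormal (θ : ℝ) (z : ℂ) :
    inner ℝ (rodNormal θ) z = Real.sin θ * z.re - Real.cos θ * z.im := by
  simp [rodNormal, Complex.inner, Complex.exp_ofReal_mul_I_re, Complex.exp_ofReal_mul_I_im]
  ring

theorem norm_rodNormal (θ : ℝ) : ‖rodNormal θ‖ = 1 := by
  simp [rodNormal, Complex.norm_exp_ofReal_mul_I]

theorem continuous_rodNormal : Continuous rodNormal := by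
  unfold rodNormal
  fun_prop

theorem rodNormal_re (θ : ℝ) : (rodNormal θ).re = Real.sin θ := by
  simp [rodNormal, Complex.exp_ofReal_mul_I_im]

theorem rodNormal_im (θ : ℝ) : (rodNormal θ).im = -Real.cos θ := by
  simp [rodNormal, Complex.exp_ofReal_mul_I_re]

theorem rodNormal_add_int_mul_two_pi (θ : ℝ) (k : ℤ) :
    rodNormal (θ + k * (2 * Real.pi)) = rodNormal θ := by
  apply Complex.ext <;> simp [rodNormal_re, rodNormal_im]

theorem hasDerivAt_chisel {ℓ : ℝ} {γ : ℝ → ℂ} {θ : ℝ → ℝ} {t ω : ℝ} {v : ℂ}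
    (hγ : HasDerivAt γ v t) (hθ : HasDerivAt θ ω t) :
    HasDerivAt (chisel ℓ γ θ) (v - (ℓ * ω : ℝ) * rodNormal (θ t)) t := by
  have h1 : HasDerivAt (fun s => (θ s : ℂ) * Complex.I) (ω * Complex.I) t :=
    hθ.ofReal_comp.mul_const _
  refine (hγ.add (h1.cexp.const_mul (ℓ : ℂ))).congr_deriv ?_
  simp only [rodNormal]
  push_cast
  ring

/-- The constraint `N · dp = 0` is the differential equation `ℓ θ' = N · q'`. -/
theorem inner_rodNormal_deriv_chisel {ℓ : ℝ} {γ : ℝ → ℂ} {θ : ℝ → ℝ} {t : ℝ}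
    (hγ : DifferentiableAt ℝ γ t) (hθ : DifferentiableAt ℝ θ t) :
    inner ℝ (rodNormal (θ t)) (deriv (chisel ℓ γ θ) t) =
      inner ℝ (rodNormal (θ t)) (deriv γ t) - ℓ * deriv θ t := by
  rw [(hasDerivAt_chisel hγ.hasDerivAt hθ.hasDerivAt).deriv, inner_sub_right,
    ← Complex.real_smul, inner_smul_right, real_inner_self_eq_norm_sq, norm_rodNormal]
  ring

/-- The angular velocity `N · q' / ℓ` that the constraint imposes on a planimeter of length `ℓ` with
angle function `θ` whose tracer point follows `γ`. -/
noncomputable def angularVelocity (ℓ : ℝ) (γ : ℝ → ℂ) (θ : ℝ → ℝ) (t : ℝ) : ℝ :=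
  inner ℝ (ℓ⁻¹ • rodNormal (θ t)) (deriv γ t)

theorem mul_angularVelocity {ℓ : ℝ} (hℓ : 0 < ℓ) (γ : ℝ → ℂ) (θ : ℝ → ℝ) (t : ℝ) :
    ℓ * angularVelocity ℓ γ θ t = inner ℝ (rodNormal (θ t)) (deriv γ t) := by
  rw [angularVelocity, real_inner_smul_left, mul_inv_cancel_left₀ hℓ.ne']

/-- `θ` is continuous and solves the planimeter equation off the finite set `T`. -/
structure SolvesPlanimeter (ℓ : ℝ) (γ : ℝ → ℂ) (θ : ℝ → ℝ) (T : Finset ℝ) : Prop where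
  continuousOn : ContinuousOn θ (Icc 0 1)
  hasDerivAt : ∀ t ∈ Ioo (0 : ℝ) 1, t ∉ T → HasDerivAt θ (angularVelocity ℓ γ θ t) t

theorem IsPlanimeterMotion.exists_solves {ℓ : ℝ} {γ : ℝ → ℂ} {θ : ℝ → ℝ} (hℓ : 0 < ℓ)
    (h : IsPlanimeterMotion ℓ γ θ) : ∃ T, SolvesPlanimeter ℓ γ θ T := by
  obtain ⟨hc, T, hT⟩ := h
  refine ⟨T, hc, fun t ht htT => ?_⟩
  obtain ⟨h1, h2, h3⟩ := hT t ht htT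
  rw [inner_rodNormal_deriv_chisel h1 h2, ← mul_angularVelocity hℓ, ← mul_sub] at h3
  have := (mul_eq_zero.1 h3).resolve_left hℓ.ne'
  rw [sub_eq_zero.1 this]
  exact h2.hasDerivAt

section

variable {ℓ : ℝ} {γ : ℝ → ℂ} {θ : ℝ → ℝ} {S T : Finset ℝ} {C : ℝ}

theorem SolvesPlanimeter.isPlanimeterMotion (hℓ : 0 < ℓ) (hγ : IsTame γ S C)
    (h : SolvesPlanimeter ℓ γ θ T) : IsPlanimeterMotion ℓ γ θ := by
  classical
  refine ⟨h.continuousOn, S ∪ T, fun t ht hST => ?_⟩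
  simp only [Finset.mem_union, not_or] at hST
  have h1 := hγ.differentiableAt ht hST.1
  have h2 := h.hasDerivAt t ht hST.2
  refine ⟨h1, h2.differentiableAt, ?_⟩
  rw [inner_rodNormal_deriv_chisel h1 h2.differentiableAt, h2.deriv, mul_angularVelocity hℓ,
    sub_self]

theorem continuousOn_rodNormal (h : ContinuousOn θ (Icc 0 1)) :
    ContinuousOn (fun t => rodNormal (θ t)) (Icc 0 1) :=
  continuous_rodNormal.comp_continuousOn h

theorem intervalIntegrable_angularVelocity (ℓ : ℝ) (hγ : IsTame γ S C)
    (h : ContinuousOn θ (Icc 0 1)) :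
    IntervalIntegrable (angularVelocity ℓ γ θ) volume 0 1 :=
  hγ.intervalIntegrable_inner ((continuousOn_rodNormal h).const_smul ℓ⁻¹)

theorem tracerRoll_eq (hℓ : 0 < ℓ) (hγ : IsTame γ S C) (h : SolvesPlanimeter ℓ γ θ T) :
    tracerRoll γ θ = ℓ * (θ 1 - θ 0) := by
  rw [← integral_eq_sub_of_finset T h.continuousOn h.hasDerivAt
    (intervalIntegrable_angularVelocity ℓ hγ h.continuousOn),
    ← intervalIntegral.integral_const_mul]
  simp only [mul_angularVelocity hℓ]
  rfl

theorem tracerRoll_le_length (hγ : IsTame γ S C) (h : ContinuousOn θ (Icc 0 1)) :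
    tracerRoll γ θ ≤ length γ := by
  refine intervalIntegral.integral_mono_on zero_le_one
    (hγ.intervalIntegrable_inner (continuousOn_rodNormal h)) hγ.intervalIntegrable_deriv.norm ?_
  intro t _
  exact (real_inner_le_norm _ _).trans (by rw [norm_rodNormal, one_mul])

theorem sweptArea_eq (hℓ : 0 < ℓ) (hγ : IsTame γ S C) (h : SolvesPlanimeter ℓ γ θ T) :
    sweptArea ℓ γ θ = ℓ / 2 * tracerRoll γ θ := by
  classical
  unfold sweptArea tracerRoll
  rw [← intervalIntegral.integral_const_mul]
  refine intervalIntegral_congr_of_finset zero_le_one (S ∪ T) fun t ht hST => ?_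
  simp only [Finset.mem_union, not_or] at hST
  have h1 := hγ.hasDerivAt ht hST.1
  have h2 := h.hasDerivAt t ht hST.2
  have h3 : HasDerivAt (fun s => (chisel ℓ γ θ s + γ s) / 2) _ t :=
    ((hasDerivAt_chisel (ℓ := ℓ) h1 h2).add h1).div_const 2
  rw [h3.deriv, mul_angularVelocity hℓ, inner_rodNormal, inner_rodNormal]
  simp only [Complex.div_ofNat_re, Complex.div_ofNat_im, Complex.add_re, Complex.sub_re,
    Complex.add_im, Complex.sub_im, Complex.re_ofReal_mul, Complex.im_ofReal_mul,
    rodNormal_re, rodNormal_im]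
  have := Real.sin_sq_add_cos_sq (θ t)
  linear_combination
    (-ℓ / 2 * (Real.sin (θ t) * (deriv γ t).re - Real.cos (θ t) * (deriv γ t).im)) * this

/-- With `p = q + ℓ e` one has `p × p' = q × q' + ℓ (q × e)' - ℓ N · q'`, and the middle term
integrates to `0` as the rod returns to its position. -/
theorem orientedArea_chisel_eq (hℓ : 0 < ℓ) (hγ : IsTame γ S C) (h : SolvesPlanimeter ℓ γ θ T)
    (h01 : γ 0 = γ 1) (hrot : θ 1 - θ 0 = 2 * Real.pi) :
    orientedArea (chisel ℓ γ θ) = orientedArea γ - ℓ / 2 * tracerRoll γ θ := by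
  classical
  -- `q · e`, `q × e`, and the derivative of the latter
  set D : ℝ → ℝ := fun t => (γ t).re * Real.cos (θ t) + (γ t).im * Real.sin (θ t) with hD
  set G : ℝ → ℝ := fun t => (γ t).re * Real.sin (θ t) - (γ t).im * Real.cos (θ t) with hG
  set G' : ℝ → ℝ := fun t => inner ℝ ((1 + D t / ℓ) • rodNormal (θ t)) (deriv γ t) with hG'
  have hre := Complex.continuous_re.comp_continuousOn hγ.continuousOn
  have him := Complex.continuous_im.comp_continuousOn hγ.continuousOn
  have hcos := Real.continuous_cos.comp_continuousOn h.continuousOn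
  have hsin := Real.continuous_sin.comp_continuousOn h.continuousOn
  have hGc : ContinuousOn G (Icc 0 1) := (hre.mul hsin).sub (him.mul hcos)
  have hDc : ContinuousOn D (Icc 0 1) := (hre.mul hcos).add (him.mul hsin)
  have hGi : IntervalIntegrable G' volume 0 1 := hγ.intervalIntegrable_inner
    ((continuousOn_const.add (hDc.div_const ℓ)).smul (continuousOn_rodNormal h.continuousOn))
  have hNi := hγ.intervalIntegrable_inner (continuousOn_rodNormal h.continuousOn)
  have hqi : IntervalIntegrable
      (fun t => (γ t).re * (deriv γ t).im - (γ t).im * (deriv γ t).re) volume 0 1 := by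
    convert hγ.intervalIntegrable_inner (u := fun t => Complex.I * γ t)
      (continuousOn_const.mul hγ.continuousOn) using 2 with t
    simp [Complex.inner]
    ring
  have hGint : ∫ t in (0 : ℝ)..1, G' t = 0 := by
    rw [integral_eq_sub_of_finset (S ∪ T) hGc _ hGi, sub_eq_zero]
    · simp [hG, sub_eq_iff_eq_add.1 hrot, add_comm (2 * Real.pi), h01]
    · intro t ht hST
      simp only [Finset.mem_union, not_or] at hST
      have h1 := hγ.hasDerivAt ht hST.1
      have h2 := h.hasDerivAt t ht hST.2
      have h3 : HasDerivAt (fun s => (γ s).re) (deriv γ t).re t :=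
        Complex.reCLM.hasFDerivAt.comp_hasDerivAt t h1
      have h4 : HasDerivAt (fun s => (γ s).im) (deriv γ t).im t :=
        Complex.imCLM.hasFDerivAt.comp_hasDerivAt t h1
      refine ((h3.mul h2.sin).sub (h4.mul h2.cos)).congr_deriv ?_
      simp only [hG', real_inner_smul_left, angularVelocity, inner_rodNormal, hD]
      field_simp
      ring
  unfold orientedArea tracerRoll
  have : ∫ t in (0 : ℝ)..1, ((chisel ℓ γ θ t).re * (deriv (chisel ℓ γ θ) t).im -
      (chisel ℓ γ θ t).im * (deriv (chisel ℓ γ θ) t).re) =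
      ∫ t in (0 : ℝ)..1, (((γ t).re * (deriv γ t).im - (γ t).im * (deriv γ t).re) + ℓ * G' t -
        ℓ * inner ℝ (rodNormal (θ t)) (deriv γ t)) := by
    refine intervalIntegral_congr_of_finset zero_le_one (S ∪ T) fun t ht hST => ?_
    simp only [Finset.mem_union, not_or] at hST
    have h1 := hγ.hasDerivAt ht hST.1
    have h2 := h.hasDerivAt t ht hST.2
    rw [(hasDerivAt_chisel (ℓ := ℓ) h1 h2).deriv, mul_angularVelocity hℓ]
    simp only [hG', real_inner_smul_left, inner_rodNormal, hD, chisel, rodNormal_re, rodNormal_im,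
      Complex.add_re, Complex.add_im, Complex.sub_re, Complex.sub_im, Complex.re_ofReal_mul,
      Complex.im_ofReal_mul, Complex.exp_ofReal_mul_I_re, Complex.exp_ofReal_mul_I_im]
    have := Real.sin_sq_add_cos_sq (θ t)
    field_simp
    linear_combination
      (ℓ * (Real.sin (θ t) * (deriv γ t).re - Real.cos (θ t) * (deriv γ t).im)) * this
  rw [this, intervalIntegral.integral_sub (hqi.add (hGi.const_mul ℓ)) (hNi.const_mul ℓ),
    intervalIntegral.integral_add hqi (hGi.const_mul ℓ), intervalIntegral.integral_const_mul,
    intervalIntegral.integral_const_mul, hGint]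
  ring

end

/-! ### Charts along the curve -/

/-- `chart γ v` sends `t + i h` to the point at height `h`, in the direction `v`, over `γ t`. -/
def chart (γ : ℝ → ℂ) (v : ℂ) (w : ℂ) : ℂ := γ w.re + w.im * v

/-- The linear map with `1 ↦ a` and `i ↦ v`, which is the derivative of `chart γ v` at points over
which `γ` has the derivative `a`. -/
noncomputable def chartDeriv (a v : ℂ) : ℂ →L[ℝ] ℂ :=
  Complex.reCLM.smulRight a + Complex.imCLM.smulRight v

theorem chartDeriv_apply (a v w : ℂ) : chartDeriv a v w = w.re * a + w.im * v := by
  simp [chartDeriv]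

theorem det_chartDeriv (a v : ℂ) : (chartDeriv a v).det = inner ℝ v (Complex.I * a) := by
  rw [ContinuousLinearMap.det, ← LinearMap.det_toMatrix Complex.basisOneI, Matrix.det_fin_two]
  simp [LinearMap.toMatrix_apply, chartDeriv_apply, Complex.inner]
  ring

theorem hasStrictFDerivAt_chart {γ : ℝ → ℂ} {a v w : ℂ} (h : HasStrictDerivAt γ a w.re) :
    HasStrictFDerivAt (chart γ v) (chartDeriv a v) w := by
  have h1 : HasStrictFDerivAt (fun w : ℂ => γ w.re) (Complex.reCLM.smulRight a) w := by
    refine (h.hasStrictFDerivAt.comp w Complex.reCLM.hasStrictFDerivAt).congr_fderiv ?_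
    ext; simp
  have h2 : HasStrictFDerivAt (fun w : ℂ => (w.im : ℂ) * v) (Complex.imCLM.smulRight v) w := by
    exact (Complex.imCLM.smulRight v).hasStrictFDerivAt.congr_of_eventuallyEq
      (.of_forall fun w => by simp)
  exact h1.add h2

theorem inner_self_I_mul (v : ℂ) : inner ℝ v (Complex.I * v) = 0 := by
  simp [Complex.inner]
  ring

section

variable {γ : ℝ → ℂ} {S : Finset ℝ} {C α β : ℝ} {v : ℂ}

/-- Over `(α, β)`, which contains no exceptional parameter, the direction `v` points strictly to the
left of `γ`. -/
structure IsTransversal (γ : ℝ → ℂ) (S : Finset ℝ) (v : ℂ) (α β : ℝ) : Prop where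
  mem : ∀ t ∈ Ioo α β, t ∈ Ioo (0 : ℝ) 1
  notMem : ∀ t ∈ Ioo α β, t ∉ S
  pos : ∀ t ∈ Ioo α β, 0 < inner ℝ v (Complex.I * deriv γ t)

theorem IsTame.hasStrictDerivAt (hγ : IsTame γ S C) {s : ℝ} (hs : s ∈ Ioo (0 : ℝ) 1)
    (hS : s ∉ S) : HasStrictDerivAt γ (deriv γ s) s :=
  (hγ.contDiffAt s hs hS).hasStrictDerivAt one_ne_zero

theorem IsTame.continuousAt_deriv (hγ : IsTame γ S C) {s : ℝ} (hs : s ∈ Ioo (0 : ℝ) 1)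
    (hS : s ∉ S) : ContinuousAt (deriv γ) s := by
  have := ((hγ.contDiffAt s hs hS).fderiv_right (m := 0) (by simp)).continuousAt
  exact this.clm_apply continuousAt_const

namespace IsTransversal

theorem ne_zero (h : IsTransversal γ S v α β) (hαβ : α < β) : v ≠ 0 := by
  rintro rfl
  simpa using h.pos ((α + β) / 2) ⟨by linarith, by linarith⟩

theorem strictMonoOn (hγ : IsTame γ S C) (h : IsTransversal γ S v α β) :
    StrictMonoOn (fun t => inner ℝ v (Complex.I * γ t)) (Ioo α β) := by
  have hd : ∀ t ∈ Ioo α β, HasDerivAt (fun t => (inner ℝ v (Complex.I * γ t) : ℝ))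
      (inner ℝ v (Complex.I * deriv γ t)) t := by
    intro t ht
    have := (innerSL ℝ v).hasFDerivAt.comp_hasDerivAt t
      ((hγ.hasDerivAt (h.mem t ht) (h.notMem t ht)).const_mul Complex.I)
    exact this
  refine strictMonoOn_of_deriv_pos (convex_Ioo α β)
    (fun t ht => (hd t ht).continuousAt.continuousWithinAt) ?_
  intro t ht
  rw [interior_Ioo] at ht
  rw [(hd t ht).deriv]
  exact h.pos t ht

theorem chart_injective (hγ : IsTame γ S C) (h : IsTransversal γ S v α β) {w w' : ℂ}
    (hw : w.re ∈ Ioo α β) (hw' : w'.re ∈ Ioo α β) (he : chart γ v w = chart γ v w') : w = w' := by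
  have hre : w.re = w'.re := by
    apply (h.strictMonoOn hγ).injOn hw hw'
    have := congrArg (fun z => (inner ℝ v (Complex.I * z) : ℝ)) he
    simp only [chart, mul_add, inner_add_right, mul_smul_comm, ← Complex.real_smul,
      inner_smul_right, inner_self_I_mul, mul_zero, add_zero] at this
    exact this
  have hv := h.ne_zero (hw.1.trans hw.2)
  refine Complex.ext hre ?_
  simp only [chart, hre, add_right_inj] at he
  exact_mod_cast mul_right_cancel₀ hv he

theorem hasStrictFDerivAt (hγ : IsTame γ S C) (h : IsTransversal γ S v α β) {w : ℂ}
    (hw : w.re ∈ Ioo α β) :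
    HasStrictFDerivAt (chart γ v) (chartDeriv (deriv γ w.re) v) w :=
  hasStrictFDerivAt_chart (hγ.hasStrictDerivAt (h.mem _ hw) (h.notMem _ hw))

theorem det_ne_zero (h : IsTransversal γ S v α β) {t : ℝ} (ht : t ∈ Ioo α β) :
    (chartDeriv (deriv γ t) v).det ≠ 0 := by
  rw [det_chartDeriv]
  exact (h.pos t ht).ne'

theorem continuousOn_chart (hγ : IsTame γ S C) (h : IsTransversal γ S v α β) :
    ContinuousOn (chart γ v) (Complex.re ⁻¹' Ioo α β) :=
  fun _ hw => (h.hasStrictFDerivAt hγ hw).hasFDerivAt.continuousAt.continuousWithinAt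

theorem isOpen_image (hγ : IsTame γ S C) (h : IsTransversal γ S v α β) {R : Set ℂ}
    (hR : IsOpen R) (hRs : ∀ w ∈ R, w.re ∈ Ioo α β) : IsOpen (chart γ v '' R) := by
  rw [isOpen_iff_mem_nhds]
  rintro _ ⟨w, hw, rfl⟩
  have hd := h.hasStrictFDerivAt hγ (hRs w hw)
  rw [← ContinuousLinearMap.coe_toContinuousLinearEquivOfDetNeZero _
    (h.det_ne_zero (hRs w hw))] at hd
  rw [← hd.map_nhds_eq_of_equiv]
  exact image_mem_map (hR.mem_nhds hw)

/-- Points on the left normal of `γ` at `t`, close to `γ t`, have a positive height in the chart, and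
points on the right normal have a negative one. -/
theorem exists_chart_eq (hγ : IsTame γ S C) (h : IsTransversal γ S v α β) {t : ℝ}
    (ht : t ∈ Ioo α β) {N : Set ℂ} (hN : N ∈ 𝓝 (t : ℂ)) :
    ∀ᶠ ε : ℝ in 𝓝[≠] 0, ∃ w ∈ N,
      chart γ v w = γ t + ε * (Complex.I * deriv γ t) ∧ SignType.sign w.im = SignType.sign ε := by
  have ht' : (t : ℂ).re ∈ Ioo α β := by simpa using ht
  have hd := h.hasStrictFDerivAt hγ ht'
  rw [Complex.ofReal_re, ← ContinuousLinearMap.coe_toContinuousLinearEquivOfDetNeZero _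
    (h.det_ne_zero ht)] at hd
  set g := hd.localInverse _ _ _ with hg
  have hct : chart γ v t = γ t := by simp [chart]
  have hgd := hd.to_localInverse.hasFDerivAt
  rw [← hg, hct] at hgd
  have hgt : g (γ t) = t := by rw [← hct]; exact hd.localInverse_apply_image
  have hline : HasDerivAt (fun ε : ℝ => γ t + ε * (Complex.I * deriv γ t))
      (Complex.I * deriv γ t) 0 := by
    simpa using ((Complex.ofRealCLM.hasDerivAt (x := 0)).mul_const
      (Complex.I * deriv γ t)).const_add (γ t)
  have hline0 : γ t + ((0 : ℝ) : ℂ) * (Complex.I * deriv γ t) = γ t := by simp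
  have hgl := HasFDerivAt.comp_hasDerivAt_of_eq (0 : ℝ) hgd hline hline0.symm
  have hgi := Complex.imCLM.hasFDerivAt.comp_hasDerivAt (0 : ℝ) hgl
  set e := (chartDeriv (deriv γ t) v).toContinuousLinearEquivOfDetNeZero (h.det_ne_zero ht)
  set u := e.symm (Complex.I * deriv γ t) with hu
  have hne : deriv γ t ≠ 0 := hγ.deriv_ne_zero t (h.mem t ht) (h.notMem t ht)
  -- `e u = i γ'`; pair this with `i γ'`
  have heu : u.re * deriv γ t + u.im * v = Complex.I * deriv γ t := by
    rw [← chartDeriv_apply]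
    exact e.apply_symm_apply _
  have hpos : 0 < u.im := by
    have h1 := congrArg (fun z => (inner ℝ z (Complex.I * deriv γ t) : ℝ)) heu
    simp only [inner_add_left, ← Complex.real_smul, real_inner_smul_left, inner_self_I_mul,
      mul_zero, zero_add] at h1
    have h2 : 0 < u.im * inner ℝ v (Complex.I * deriv γ t) := by
      rw [h1, real_inner_self_eq_norm_sq]
      have : Complex.I * deriv γ t ≠ 0 := mul_ne_zero Complex.I_ne_zero hne
      positivity
    exact pos_of_mul_pos_left h2 (h.pos t ht).le
  have hsign := eventually_nhdsWithin_sign_eq_of_deriv_pos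
    (f := fun ε : ℝ => (g (γ t + ε * (Complex.I * deriv γ t))).im) (x₀ := 0)
    (by
      have : deriv (fun ε : ℝ => (g (γ t + ε * (Complex.I * deriv γ t))).im) 0 = u.im := hgi.deriv
      rw [this]
      exact hpos)
    (by simp [hgt])
  have hcont : Tendsto (fun ε : ℝ => γ t + ε * (Complex.I * deriv γ t)) (𝓝 0) (𝓝 (γ t)) := by
    have := hline.continuousAt.tendsto
    rwa [hline0] at this
  have hev : ∀ᶠ z in 𝓝 (γ t), g z ∈ N ∧ chart γ v (g z) = z := by
    refine Filter.Eventually.and ?_ ?_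
    · have := hgd.continuousAt.tendsto
      rw [hgt] at this
      exact this hN
    · rw [← hct]
      exact hd.eventually_right_inverse
  filter_upwards [nhdsWithin_le_nhds hsign, nhdsWithin_le_nhds (hcont.eventually hev)]
    with ε h1 h2
  exact ⟨_, h2.1, h2.2, by simpa using h1⟩

end IsTransversal

end

/-! ### Green's formula in a chart -/

/-- A test function: `C¹` and compactly supported. -/
structure IsTest (φ : ℂ → ℝ) : Prop where
  contDiff : ContDiff ℝ 1 φ
  hasCompactSupport : HasCompactSupport φ

namespace IsTest

variable {φ ψ : ℂ → ℝ}

theorem continuous (h : IsTest φ) : Continuous φ := h.contDiff.continuous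

theorem differentiable (h : IsTest φ) : Differentiable ℝ φ := h.contDiff.differentiable one_ne_zero

theorem continuous_fderiv_apply (h : IsTest φ) (v : ℂ) : Continuous fun z => fderiv ℝ φ z v :=
  (h.contDiff.continuous_fderiv one_ne_zero).clm_apply continuous_const

theorem hasCompactSupport_fderiv_apply (h : IsTest φ) (v : ℂ) :
    HasCompactSupport fun z => fderiv ℝ φ z v :=
  h.hasCompactSupport.fderiv_apply ℝ v

theorem integrable (h : IsTest φ) (v : ℂ) : Integrable fun z => fderiv ℝ φ z v :=
  (h.continuous_fderiv_apply v).integrable_of_hasCompactSupport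
    (h.hasCompactSupport_fderiv_apply v)

theorem exists_bound (h : IsTest φ) : ∃ M, ∀ z, ‖φ z‖ ≤ M :=
  h.hasCompactSupport.exists_bound_of_continuous h.continuous

theorem exists_bound_fderiv (h : IsTest φ) (v : ℂ) : ∃ M, ∀ z, ‖fderiv ℝ φ z v‖ ≤ M :=
  (h.hasCompactSupport_fderiv_apply v).exists_bound_of_continuous (h.continuous_fderiv_apply v)

theorem add (h : IsTest φ) (h' : IsTest ψ) : IsTest (fun z => φ z + ψ z) :=
  ⟨h.contDiff.add h'.contDiff, h.hasCompactSupport.add h'.hasCompactSupport⟩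

theorem mul (h : IsTest φ) {ψ : ℂ → ℝ} (h' : ContDiff ℝ 1 ψ) : IsTest (fun z => ψ z * φ z) :=
  ⟨h'.mul h.contDiff, h.hasCompactSupport.mul_left⟩

theorem fderiv_eq_zero {z : ℂ} (v : ℂ) (hz : z ∉ tsupport φ) : fderiv ℝ φ z v = 0 := by
  rw [fderiv_of_notMem_tsupport ℝ hz]
  rfl

theorem integral_fderiv_eq_zero (h : IsTest φ) (v : ℂ) : ∫ z, fderiv ℝ φ z v = 0 := by
  have := integral_bilinear_hasFDerivAt_right_eq_neg_left_of_integrable (μ := volume)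
    (f := fun _ : ℂ => (1 : ℝ)) (f' := fun _ => 0) (g := φ) (g' := fderiv ℝ φ) (v := v)
    (B := ContinuousLinearMap.mul ℝ ℝ) (by simp) (by simpa using h.integrable v)
    (by simpa using h.continuous.integrable_of_hasCompactSupport h.hasCompactSupport)
    (fun _ _ => hasFDerivAt_const _ _) (fun x _ => h.differentiable.differentiableAt.hasFDerivAt)
  simpa using this

end IsTest

theorem measurableSet_Ioo_reProdIm (α β a b : ℝ) : MeasurableSet (Ioo α β ×ℂ Ioo a b) :=
  (isOpen_Ioo.reProdIm isOpen_Ioo).measurableSet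

theorem setIntegral_Ioo_reProdIm {f : ℂ → ℝ} {α β a b : ℝ}
    (hf : IntegrableOn f (Ioo α β ×ℂ Ioo a b)) :
    ∫ z in Ioo α β ×ℂ Ioo a b, f z = ∫ t in Ioo α β, ∫ h in Ioo a b, f (t + h * Complex.I) := by
  have hpre : Complex.measurableEquivRealProd.symm ⁻¹' (Ioo α β ×ℂ Ioo a b) =
      Ioo α β ×ˢ Ioo a b := by
    ext p
    simp [Complex.mem_reProdIm, Complex.measurableEquivRealProd_symm_apply]
  have hmp := Complex.volume_preserving_equiv_real_prod.symm
  have he := Complex.measurableEquivRealProd.symm.measurableEmbedding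
  rw [← hmp.setIntegral_preimage_emb he, hpre, Measure.volume_eq_prod, setIntegral_prod]
  · simp [Complex.measurableEquivRealProd_symm_apply, Complex.mk_eq_add_mul_I]
  · rw [← hpre, ← Measure.volume_eq_prod]
    exact (hmp.integrableOn_comp_preimage he).2 hf

namespace IsTransversal

variable {γ : ℝ → ℂ} {S : Finset ℝ} {C α β : ℝ} {v : ℂ} {φ : ℂ → ℝ}

/-- In the chart the derivative along `v` is the derivative in the height, and the Jacobian does
not depend on the height. -/
theorem setIntegral_chart_image (hγ : IsTame γ S C) (h : IsTransversal γ S v α β)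
    (hφ : IsTest φ) {a b : ℝ} (hab : a ≤ b) :
    ∫ z in chart γ v '' (Ioo α β ×ℂ Ioo a b), fderiv ℝ φ z v =
      ∫ t in Ioo α β, inner ℝ v (Complex.I * deriv γ t) *
        (φ (γ t + b * v) - φ (γ t + a * v)) := by
  have hre : ∀ w ∈ Ioo α β ×ℂ Ioo a b, w.re ∈ Ioo α β := fun w hw => hw.1
  rw [integral_image_eq_integral_abs_det_fderiv_smul volume (measurableSet_Ioo_reProdIm _ _ _ _)
    (fun w hw => (h.hasStrictFDerivAt hγ (hre w hw)).hasFDerivAt.hasFDerivWithinAt)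
    (fun w hw w' hw' he => h.chart_injective hγ (hre w hw) (hre w' hw') he)]
  have hcongr : ∀ w ∈ Ioo α β ×ℂ Ioo a b,
      |(chartDeriv (deriv γ w.re) v).det| • fderiv ℝ φ (chart γ v w) v =
        inner ℝ v (Complex.I * deriv γ w.re) * fderiv ℝ φ (chart γ v w) v := by
    intro w hw
    rw [det_chartDeriv, abs_of_pos (h.pos _ (hre w hw)), smul_eq_mul]
  rw [setIntegral_congr_fun (measurableSet_Ioo_reProdIm _ _ _ _) hcongr, setIntegral_Ioo_reProdIm]
  · refine setIntegral_congr_fun measurableSet_Ioo fun t ht => ?_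
    simp only [chart, Complex.add_re, Complex.ofReal_re, Complex.re_ofReal_mul, Complex.I_re,
      mul_zero, add_zero, Complex.add_im, Complex.ofReal_im, Complex.im_ofReal_mul, Complex.I_im,
      mul_one, zero_add]
    rw [integral_const_mul, ← integral_Ioc_eq_integral_Ioo, ← intervalIntegral.integral_of_le hab]
    congr 1
    refine intervalIntegral.integral_eq_sub_of_hasDerivAt
      (f := fun x : ℝ => φ (γ t + x * v)) (fun x _ => ?_) ?_
    · have h1 : HasDerivAt (fun x : ℝ => γ t + x * v) v x := by
        simpa using ((Complex.ofRealCLM.hasDerivAt (x := x)).mul_const v).const_add (γ t)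
      exact (hφ.differentiable _).hasFDerivAt.comp_hasDerivAt x h1
    · refine Continuous.intervalIntegrable ?_ _ _
      exact (hφ.continuous_fderiv_apply v).comp (by fun_prop)
  · obtain ⟨M, hM⟩ := hφ.exists_bound_fderiv v
    have hfin : volume (Ioo α β ×ℂ Ioo a b) < ⊤ := by
      refine Bornology.IsBounded.measure_lt_top ?_
      exact (Metric.isBounded_Ioo _ _).reProdIm (Metric.isBounded_Ioo _ _)
    have : IsFiniteMeasure (volume.restrict (Ioo α β ×ℂ Ioo a b)) := ⟨by simpa using hfin⟩
    refine Integrable.of_bound ?_ (‖v‖ * C * M) ?_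
    · refine ContinuousOn.aestronglyMeasurable ?_ (measurableSet_Ioo_reProdIm _ _ _ _)
      have h1 : ContinuousOn (fun w : ℂ => deriv γ w.re) (Ioo α β ×ℂ Ioo a b) := by
        intro w hw
        exact ((hγ.continuousAt_deriv (h.mem _ hw.1) (h.notMem _ hw.1)).comp
          Complex.continuous_re.continuousAt).continuousWithinAt
      refine (continuousOn_const.inner (continuousOn_const.mul h1)).mul ?_
      exact (hφ.continuous_fderiv_apply v).comp_continuousOn
        ((h.continuousOn_chart hγ).mono hre)
    · filter_upwards [ae_restrict_mem (measurableSet_Ioo_reProdIm _ _ _ _)] with w hw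
      rw [norm_mul]
      have h1 : ‖(inner ℝ v (Complex.I * deriv γ w.re) : ℝ)‖ ≤ ‖v‖ * C := by
        refine (norm_inner_le_norm _ _).trans ?_
        rw [norm_mul, Complex.norm_I, one_mul]
        gcongr
        exact hγ.norm_deriv_le _ (h.mem _ hw.1) (h.notMem _ hw.1)
      exact mul_le_mul h1 (hM _) (norm_nonneg _) ((norm_nonneg _).trans h1)

end IsTransversal

/-! ### Green's formula near a smooth point of the boundary -/

open Classical in
/-- The weight `1` of the parameters at which `Ω` does not lie on the right of `γ`, and `0` of
those at which it does. The Jordan curve theorem would give that the latter do not occur. -/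
noncomputable def rightWeight (Ω : Set ℂ) (γ : ℝ → ℂ) (t : ℝ) : ℝ :=
  if ∃ᶠ ε : ℝ in 𝓝[>] 0, γ t - ε * (Complex.I * deriv γ t) ∈ Ω then 0 else 1

/-- Green's formula for the vector field `φ v` on `Ω`, whose boundary is weighted by
`rightWeight`. -/
def GreenFor (Ω : Set ℂ) (γ : ℝ → ℂ) (φ : ℂ → ℝ) (v : ℂ) : Prop :=
  ∫ z in Ω, fderiv ℝ φ z v =
    ∫ t in (0 : ℝ)..1, rightWeight Ω γ t * (φ (γ t) * inner ℝ v (-(Complex.I * deriv γ t)))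

theorem subset_or_disjoint_of_disjoint_frontier {Ω A : Set ℂ} (hΩ : IsOpen Ω)
    (hA : IsPreconnected A) (h : Disjoint A (frontier Ω)) : A ⊆ Ω ∨ Disjoint A Ω := by
  have hcov : A ⊆ Ω ∪ (closure Ω)ᶜ := by
    intro z hz
    by_cases hzc : z ∈ closure Ω
    · left
      by_contra hzΩ
      exact disjoint_left.1 h hz (by rw [hΩ.frontier_eq]; exact ⟨hzc, hzΩ⟩)
    · exact Or.inr hzc
  rcases hA.subset_or_subset hΩ isClosed_closure.isOpen_compl
    (disjoint_compl_right.mono_left subset_closure) hcov with h1 | h1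
  · exact Or.inl h1
  · exact Or.inr (disjoint_left.2 fun z hz hzΩ => h1 hz (subset_closure hzΩ))

theorem isPreconnected_Ioo_reProdIm (α β a b : ℝ) : IsPreconnected (Ioo α β ×ℂ Ioo a b) :=
  (((convex_Ioo α β).linear_preimage Complex.reLm).inter
    ((convex_Ioo a b).linear_preimage Complex.imLm)).isPreconnected

section

variable {Ω : Set ℂ} {γ : ℝ → ℂ} {S : Finset ℝ} {C : ℝ} {v : ℂ} {s : ℝ}

theorem IsRegion.eq_of_apply_eq (hΩ : IsRegion Ω γ) (hs : s ∈ Ioo (0 : ℝ) 1) {t : ℝ}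
    (ht : t ∈ Icc (0 : ℝ) 1) (h : γ t = γ s) : t = s := by
  rcases ht.2.lt_or_eq with h1 | rfl
  · exact hΩ.simple ⟨ht.1, h1⟩ ⟨hs.1.le, hs.2⟩ h
  · have := hΩ.simple ⟨le_rfl, zero_lt_one⟩ ⟨hs.1.le, hs.2⟩ (hΩ.closed.trans h)
    exact absurd this hs.1.ne

theorem IsRegion.mem_frontier (hΩ : IsRegion Ω γ) {t : ℝ} (ht : t ∈ Icc (0 : ℝ) 1) :
    γ t ∈ frontier Ω := by
  rw [hΩ.frontier_eq]
  exact mem_image_of_mem γ ht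

theorem IsRegion.notMem (hΩ : IsRegion Ω γ) {t : ℝ} (ht : t ∈ Icc (0 : ℝ) 1) : γ t ∉ Ω := by
  have := hΩ.mem_frontier ht
  rw [hΩ.isOpen.frontier_eq] at this
  exact this.2

/-- In a small box around a smooth point the chart meets the boundary only at height `0`. -/
theorem IsRegion.exists_isTransversal (hΩ : IsRegion Ω γ) (hγ : IsTame γ S C)
    (hs : s ∈ Ioo (0 : ℝ) 1) (hS : s ∉ S) (hv : 0 < inner ℝ v (Complex.I * deriv γ s)) :
    ∃ r > 0, IsTransversal γ S v (s - r) (s + r) ∧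
      ∀ w ∈ Ioo (s - r) (s + r) ×ℂ Ioo (-r) r, ∀ t ∈ Icc (0 : ℝ) 1, chart γ v w = γ t → w = t := by
  have hev : ∀ᶠ t in 𝓝 s, t ∈ Ioo (0 : ℝ) 1 ∧ t ∉ S ∧ 0 < inner ℝ v (Complex.I * deriv γ t) := by
    refine Filter.Eventually.and (isOpen_Ioo.mem_nhds hs) (Filter.Eventually.and ?_ ?_)
    · exact S.finite_toSet.isClosed.isOpen_compl.mem_nhds hS
    · have : ContinuousAt (fun t => (inner ℝ v (Complex.I * deriv γ t) : ℝ)) s :=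
        continuousAt_const.inner (continuousAt_const.mul (hγ.continuousAt_deriv hs hS))
      exact this.eventually (lt_mem_nhds hv)
  obtain ⟨δ, hδ, hball⟩ := Metric.eventually_nhds_iff_ball.1 hev
  rw [Real.ball_eq_Ioo] at hball
  have htr : IsTransversal γ S v (s - δ) (s + δ) :=
    ⟨fun t ht => (hball t ht).1, fun t ht => (hball t ht).2.1, fun t ht => (hball t ht).2.2⟩
  -- the rest of the curve is a compact set at a positive distance
  have hK : IsCompact (γ '' (Icc 0 1 \ Ioo (s - δ) (s + δ))) :=
    (isCompact_Icc.diff isOpen_Ioo).image_of_continuousOn (hγ.continuousOn.mono sdiff_subset)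
  have hsK : γ s ∉ γ '' (Icc 0 1 \ Ioo (s - δ) (s + δ)) := by
    rintro ⟨t, ht, he⟩
    rw [hΩ.eq_of_apply_eq hs ht.1 he] at ht
    exact ht.2 ⟨by linarith, by linarith⟩
  have hcs : chart γ v s = γ s := by simp [chart]
  have hsδ : (s : ℂ).re ∈ Ioo (s - δ) (s + δ) := by simp [hδ]
  have hcont : ContinuousAt (chart γ v) (s : ℂ) :=
    (htr.hasStrictFDerivAt hγ hsδ).hasFDerivAt.continuousAt
  have hev2 : ∀ᶠ w in 𝓝 (s : ℂ), chart γ v w ∉ γ '' (Icc 0 1 \ Ioo (s - δ) (s + δ)) := by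
    refine hcont.eventually (hK.isClosed.isOpen_compl.mem_nhds ?_)
    rwa [hcs]
  obtain ⟨η, hη, hball2⟩ := Metric.eventually_nhds_iff_ball.1 hev2
  have hr1 : min δ (η / 2) ≤ δ := min_le_left _ _
  have hr2 : min δ (η / 2) ≤ η / 2 := min_le_right _ _
  set r := min δ (η / 2) with hr
  have hsub : Ioo (s - r) (s + r) ⊆ Ioo (s - δ) (s + δ) :=
    Ioo_subset_Ioo (by linarith) (by linarith)
  refine ⟨r, lt_min hδ (by linarith), ⟨fun t ht => htr.mem t (hsub ht),
    fun t ht => htr.notMem t (hsub ht), fun t ht => htr.pos t (hsub ht)⟩, ?_⟩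
  intro w hw t ht he
  have hwb : w ∈ Metric.ball (s : ℂ) η := by
    rw [Metric.mem_ball, dist_eq_norm]
    refine (Complex.norm_le_abs_re_add_abs_im _).trans_lt ?_
    have h1 : |w.re - s| < r := abs_lt.2 ⟨by linarith [hw.1.1], by linarith [hw.1.2]⟩
    have h2 : |w.im| < r := abs_lt.2 hw.2
    simp only [Complex.sub_re, Complex.ofReal_re, Complex.sub_im, Complex.ofReal_im, sub_zero]
    linarith
  have hnot := hball2 w hwb
  rw [he] at hnot
  have htI : t ∈ Ioo (s - δ) (s + δ) := by
    by_contra hc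
    exact hnot ⟨t, ⟨ht, hc⟩, rfl⟩
  refine htr.chart_injective hγ (hsub hw.1) (by simpa using htI) ?_
  rw [he]
  simp [chart]

/-- Near a smooth point of the curve the weight is constant, and Green's formula holds for the
directions that point to the left. -/
theorem IsRegion.local_green_of_pos (hΩ : IsRegion Ω γ) (hγ : IsTame γ S C)
    (hs : s ∈ Ioo (0 : ℝ) 1) (hS : s ∉ S) (hv : 0 < inner ℝ v (Complex.I * deriv γ s)) :
    (∀ᶠ t in 𝓝 s, rightWeight Ω γ t = rightWeight Ω γ s) ∧
    ∃ U ∈ 𝓝 (γ s), ∀ φ, IsTest φ → tsupport φ ⊆ U → GreenFor Ω γ φ v := by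
  obtain ⟨r, hr, htr, hbox⟩ := hΩ.exists_isTransversal hγ hs hS hv
  set I := Ioo (s - r) (s + r) with hI
  have hsI : s ∈ I := ⟨by linarith, by linarith⟩
  set U := chart γ v '' (I ×ℂ Ioo (-r) r) with hU
  set L := chart γ v '' (I ×ℂ Ioo 0 r) with hL
  set R := chart γ v '' (I ×ℂ Ioo (-r) 0) with hR
  have hbL : I ×ℂ Ioo 0 r ⊆ I ×ℂ Ioo (-r) r :=
    fun w hw => ⟨hw.1, by linarith [hw.2.1], hw.2.2⟩
  have hbR : I ×ℂ Ioo (-r) 0 ⊆ I ×ℂ Ioo (-r) r :=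
    fun w hw => ⟨hw.1, hw.2.1, by linarith [hw.2.2]⟩
  have hopen : ∀ a b, IsOpen (chart γ v '' (I ×ℂ Ioo a b)) := fun a b =>
    htr.isOpen_image hγ (isOpen_Ioo.reProdIm isOpen_Ioo) fun w hw => hw.1
  have hconn : ∀ a b, IsPreconnected (chart γ v '' (I ×ℂ Ioo a b)) := fun a b =>
    (isPreconnected_Ioo_reProdIm _ _ _ _).image _
      ((htr.continuousOn_chart hγ).mono fun w hw => hw.1)
  have hfront : ∀ w ∈ I ×ℂ Ioo (-r) r, chart γ v w ∈ frontier Ω → w.im = 0 := by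
    intro w hw hf
    rw [hΩ.frontier_eq] at hf
    obtain ⟨t, ht, he⟩ := hf
    rw [hbox w hw t ht he.symm, Complex.ofReal_im]
  have hdL : Disjoint L (frontier Ω) := by
    rw [disjoint_left]
    rintro _ ⟨w, hw, rfl⟩ hf
    exact hw.2.1.ne' (hfront w (hbL hw) hf)
  have hdR : Disjoint R (frontier Ω) := by
    rw [disjoint_left]
    rintro _ ⟨w, hw, rfl⟩ hf
    exact hw.2.2.ne (hfront w (hbR hw) hf)
  have hnhds : ∀ t ∈ I, I ×ℂ Ioo (-r) r ∈ 𝓝 (t : ℂ) := fun t ht =>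
    (isOpen_Ioo.reProdIm isOpen_Ioo).mem_nhds ⟨ht, by simpa using hr⟩
  have hleft : ∀ t ∈ I, ∀ᶠ ε : ℝ in 𝓝[>] 0, γ t + ε * (Complex.I * deriv γ t) ∈ L := by
    intro t ht
    have h1 := (htr.exists_chart_eq hγ ht (hnhds t ht)).filter_mono
      (nhdsWithin_mono 0 (fun x (hx : (0 : ℝ) < x) => hx.ne'))
    filter_upwards [h1, self_mem_nhdsWithin] with ε ⟨w, hw, he, hsgn⟩ hε
    rw [sign_pos (mem_Ioi.1 hε), sign_eq_one_iff] at hsgn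
    exact ⟨w, ⟨hw.1, hsgn, hw.2.2⟩, he⟩
  have hright : ∀ t ∈ I, ∀ᶠ ε : ℝ in 𝓝[>] 0, γ t - ε * (Complex.I * deriv γ t) ∈ R := by
    intro t ht
    have htend : Tendsto (fun ε : ℝ => -ε) (𝓝[>] 0) (𝓝[≠] 0) := by
      refine tendsto_nhdsWithin_iff.2 ⟨?_, ?_⟩
      · have := (continuous_neg (G := ℝ)).tendsto 0
        rw [neg_zero] at this
        exact this.mono_left nhdsWithin_le_nhds
      · filter_upwards [self_mem_nhdsWithin] with ε hε
        exact neg_ne_zero.2 (ne_of_gt hε)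
    have h1 := htend.eventually (htr.exists_chart_eq hγ ht (hnhds t ht))
    filter_upwards [h1, self_mem_nhdsWithin] with ε ⟨w, hw, he, hsgn⟩ hε
    rw [sign_neg (neg_lt_zero.2 (mem_Ioi.1 hε)), sign_eq_neg_one_iff] at hsgn
    refine ⟨w, ⟨hw.1, hw.2.1, hsgn⟩, ?_⟩
    rw [he]
    push_cast
    ring
  have hLΩ : L ⊆ Ω := by
    refine (subset_or_disjoint_of_disjoint_frontier hΩ.isOpen (hconn _ _) hdL).resolve_right ?_
    intro hd
    obtain ⟨ε, h1, h2⟩ := ((hleft s hsI).and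
      (hΩ.positive s hs _ (hγ.hasDerivAt hs hS))).exists
    exact disjoint_left.1 hd h1 h2
  have hRΩ := subset_or_disjoint_of_disjoint_frontier hΩ.isOpen (hconn _ _) hdR
  -- the two values of the weight
  have hw0 : R ⊆ Ω → ∀ t ∈ I, rightWeight Ω γ t = 0 := fun h t ht =>
    if_pos ((hright t ht).mono fun ε hε => h hε).frequently
  have hw1 : Disjoint R Ω → ∀ t ∈ I, rightWeight Ω γ t = 1 := fun h t ht =>
    if_neg (not_frequently.2 ((hright t ht).mono fun ε hε => disjoint_left.1 h hε))
  have hconst : ∀ t ∈ I, rightWeight Ω γ t = rightWeight Ω γ s := by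
    intro t ht
    rcases hRΩ with h | h
    · rw [hw0 h t ht, hw0 h s hsI]
    · rw [hw1 h t ht, hw1 h s hsI]
  refine ⟨Filter.mem_of_superset (isOpen_Ioo.mem_nhds hsI) hconst, U, ?_, ?_⟩
  · refine (hopen _ _).mem_nhds ⟨s, ⟨by simpa using hsI, by simpa using hr⟩, by simp [chart]⟩
  intro φ hφ hsupp
  have hφU : ∀ z ∉ U, φ z = 0 := fun z hz => image_eq_zero_of_notMem_tsupport (mt (@hsupp z) hz)
  have hfU : ∀ z ∉ U, fderiv ℝ φ z v = 0 := fun z hz =>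
    IsTest.fderiv_eq_zero v (mt (@hsupp z) hz)
  -- the top and the bottom of the box lie outside `U`
  have hout : ∀ t ∈ I, ∀ h : ℝ, h ∉ Ioo (-r) r → φ (γ t + h * v) = 0 := by
    intro t ht h hh
    apply hφU
    rintro ⟨w, hw, he⟩
    have := htr.chart_injective hγ (w' := t + h * Complex.I) hw.1 (by simpa [hI] using ht)
      (by rw [he]; simp [chart])
    apply hh
    have h2 := hw.2
    rw [this] at h2
    simpa using h2
  have hLint : ∫ z in L, fderiv ℝ φ z v =
      -∫ t in I, inner ℝ v (Complex.I * deriv γ t) * φ (γ t) := by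
    rw [hL, htr.setIntegral_chart_image hγ hφ hr.le, ← integral_neg]
    refine setIntegral_congr_fun measurableSet_Ioo fun t ht => ?_
    simp only [hout t ht r (by simp), Complex.ofReal_zero, zero_mul, add_zero]
    ring
  have hRint : ∫ z in R, fderiv ℝ φ z v =
      ∫ t in I, inner ℝ v (Complex.I * deriv γ t) * φ (γ t) := by
    rw [hR, htr.setIntegral_chart_image hγ hφ (neg_nonpos.2 hr.le)]
    refine setIntegral_congr_fun measurableSet_Ioo fun t ht => ?_
    simp only [hout t ht (-r) (by simp), Complex.ofReal_zero, zero_mul, add_zero]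
    ring
  have hLR : Disjoint L R := by
    rw [disjoint_left]
    rintro _ ⟨w, hw, rfl⟩ ⟨w', hw', he⟩
    have := htr.chart_injective hγ hw'.1 hw.1 he
    rw [this] at hw'
    exact lt_asymm hw.2.1 hw'.2.2
  have hUΩ : ∀ z ∈ U, z ∈ Ω → z ∈ L ∪ R := by
    rintro _ ⟨w, hw, rfl⟩ hz
    rcases lt_trichotomy w.im 0 with h | h | h
    · exact Or.inr ⟨w, ⟨hw.1, hw.2.1, h⟩, rfl⟩
    · have : chart γ v w = γ w.re := by simp [chart, h]
      rw [this] at hz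
      have := htr.mem _ hw.1
      exact absurd hz (hΩ.notMem ⟨this.1.le, this.2.le⟩)
    · exact Or.inl ⟨w, ⟨hw.1, h, hw.2.2⟩, rfl⟩
  have hrhs : ∫ t in (0 : ℝ)..1, rightWeight Ω γ t *
      (φ (γ t) * inner ℝ v (-(Complex.I * deriv γ t))) =
      -(rightWeight Ω γ s * ∫ t in I, inner ℝ v (Complex.I * deriv γ t) * φ (γ t)) := by
    rw [intervalIntegral.integral_of_le zero_le_one,
      setIntegral_eq_of_subset_of_forall_sdiff_eq_zero (s := I) measurableSet_Ioc
        (fun t ht => Ioo_subset_Ioc_self (htr.mem t ht)), ← neg_mul, ← integral_const_mul]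
    · refine setIntegral_congr_fun measurableSet_Ioo fun t ht => ?_
      simp only [hconst t ht, inner_neg_right]
      ring
    · intro t ht
      have : γ t ∉ U := by
        rintro ⟨w, hw, he⟩
        have h1 := hbox w hw t (Ioc_subset_Icc_self ht.1) he
        have h2 := hw.1
        rw [h1] at h2
        exact ht.2 (by simpa using h2)
      rw [hφU _ this]
      ring
  unfold GreenFor
  rw [hrhs]
  rcases hRΩ with h | h
  · rw [hw0 h s hsI, zero_mul, neg_zero,
      setIntegral_eq_of_subset_of_forall_sdiff_eq_zero hΩ.isOpen.measurableSet
        (union_subset hLΩ h), setIntegral_union hLR (hopen _ _).measurableSet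
        (hφ.integrable v).integrableOn (hφ.integrable v).integrableOn, hLint, hRint,
      neg_add_cancel]
    intro z hz
    exact hfU z fun hzU => hz.2 (hUΩ z hzU hz.1)
  · rw [hw1 h s hsI, one_mul, ← hLint,
      setIntegral_eq_of_subset_of_forall_sdiff_eq_zero hΩ.isOpen.measurableSet hLΩ]
    intro z hz
    refine hfU z fun hzU => (hUΩ z hzU hz.1).elim hz.2 fun hzR => ?_
    exact disjoint_left.1 h hzR hz.1

end

/-! ### Green's formula away from the corners -/

section

variable {Ω : Set ℂ} {γ : ℝ → ℂ} {S : Finset ℝ} {C : ℝ} {v : ℂ} {s : ℝ} {φ ψ : ℂ → ℝ}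

theorem IsTame.inner_I_mul_deriv_pos (hγ : IsTame γ S C) (hs : s ∈ Ioo (0 : ℝ) 1) (hS : s ∉ S) :
    0 < inner ℝ (Complex.I * deriv γ s) (Complex.I * deriv γ s) :=
  real_inner_self_pos.2 (mul_ne_zero Complex.I_ne_zero (hγ.deriv_ne_zero s hs hS))

theorem IsRegion.eventually_rightWeight_eq (hΩ : IsRegion Ω γ) (hγ : IsTame γ S C)
    (hs : s ∈ Ioo (0 : ℝ) 1) (hS : s ∉ S) :
    ∀ᶠ t in 𝓝 s, rightWeight Ω γ t = rightWeight Ω γ s :=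
  (hΩ.local_green_of_pos hγ hs hS (hγ.inner_I_mul_deriv_pos hs hS)).1

theorem norm_rightWeight_le (Ω : Set ℂ) (γ : ℝ → ℂ) (t : ℝ) : ‖rightWeight Ω γ t‖ ≤ 1 := by
  unfold rightWeight
  split_ifs <;> simp

theorem IsRegion.aestronglyMeasurable_rightWeight (hΩ : IsRegion Ω γ) (hγ : IsTame γ S C) :
    AEStronglyMeasurable (rightWeight Ω γ) (volume.restrict (uIoc (0 : ℝ) 1)) := by
  have hmeas : MeasurableSet (Ioo (0 : ℝ) 1 \ S) := measurableSet_Ioo.diff S.measurableSet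
  have h1 : AEStronglyMeasurable (rightWeight Ω γ) (volume.restrict (Ioo (0 : ℝ) 1 \ S)) := by
    refine ContinuousOn.aestronglyMeasurable (fun s hs => ?_) hmeas
    have := hΩ.eventually_rightWeight_eq hγ hs.1 hs.2
    exact (continuousAt_const.congr (this.mono fun t ht => ht.symm)).continuousWithinAt
  rwa [uIoc_of_le zero_le_one, ← restrict_Ioo_eq_restrict_Ioc, ← Measure.restrict_congr_set
    (sdiff_null_ae_eq_self (S.finite_toSet.measure_zero volume))]

theorem IsRegion.intervalIntegrable_green (hΩ : IsRegion Ω γ) (hγ : IsTame γ S C)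
    (hφ : IsTest φ) (v : ℂ) : IntervalIntegrable (fun t => rightWeight Ω γ t *
      (φ (γ t) * inner ℝ v (-(Complex.I * deriv γ t)))) volume 0 1 := by
  obtain ⟨M, hM⟩ := hφ.exists_bound
  have hm : AEStronglyMeasurable (fun t => φ (γ t)) (volume.restrict (uIoc (0 : ℝ) 1)) :=
    aestronglyMeasurable_uIoc_of_continuousOn (hφ.continuous.comp_continuousOn hγ.continuousOn)
  refine intervalIntegrable_of_finset S (1 * (M * (‖v‖ * C)))
    ((hΩ.aestronglyMeasurable_rightWeight hγ).mul (hm.mul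
      (aestronglyMeasurable_const.inner (((aestronglyMeasurable_deriv_uIoc γ).const_mul _).neg))))
    fun t ht hS => ?_
  have h1 : ‖(inner ℝ v (-(Complex.I * deriv γ t)) : ℝ)‖ ≤ ‖v‖ * C := by
    refine (norm_inner_le_norm _ _).trans ?_
    rw [norm_neg, norm_mul, Complex.norm_I, one_mul]
    gcongr
    exact hγ.norm_deriv_le t ht hS
  have hM0 : 0 ≤ M := (norm_nonneg _).trans (hM 0)
  rw [norm_mul, norm_mul]
  exact mul_le_mul (norm_rightWeight_le Ω γ t) (mul_le_mul (hM _) h1 (norm_nonneg _) hM0)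
    (by positivity) zero_le_one

theorem GreenFor.add_smul (hΩ : IsRegion Ω γ) (hγ : IsTame γ S C) (hφ : IsTest φ) {v₁ v₂ : ℂ}
    (h₁ : GreenFor Ω γ φ v₁) (h₂ : GreenFor Ω γ φ v₂) (a b : ℝ) :
    GreenFor Ω γ φ (a • v₁ + b • v₂) := by
  unfold GreenFor at *
  simp only [map_add, map_smul, smul_eq_mul]
  rw [integral_add ((hφ.integrable v₁).integrableOn.const_mul a)
    ((hφ.integrable v₂).integrableOn.const_mul b), integral_const_mul, integral_const_mul, h₁, h₂,
    ← intervalIntegral.integral_const_mul, ← intervalIntegral.integral_const_mul,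
    ← intervalIntegral.integral_add ((hΩ.intervalIntegrable_green hγ hφ v₁).const_mul a)
      ((hΩ.intervalIntegrable_green hγ hφ v₂).const_mul b)]
  congr 1
  ext t
  rw [inner_add_left, real_inner_smul_left, real_inner_smul_left]
  ring

theorem GreenFor.add (hΩ : IsRegion Ω γ) (hγ : IsTame γ S C) (hφ : IsTest φ) (hψ : IsTest ψ)
    (h₁ : GreenFor Ω γ φ v) (h₂ : GreenFor Ω γ ψ v) : GreenFor Ω γ (fun z => φ z + ψ z) v := by
  unfold GreenFor at *
  have : ∀ z, fderiv ℝ (fun z => φ z + ψ z) z v = fderiv ℝ φ z v + fderiv ℝ ψ z v := fun z => by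
    rw [fderiv_fun_add (hφ.differentiable z) (hψ.differentiable z)]
    rfl
  simp only [this]
  rw [integral_add (hφ.integrable v).integrableOn (hψ.integrable v).integrableOn, h₁, h₂,
    ← intervalIntegral.integral_add (hΩ.intervalIntegrable_green hγ hφ v)
      (hΩ.intervalIntegrable_green hγ hψ v)]
  congr 1
  ext t
  ring

theorem GreenFor.sum (hΩ : IsRegion Ω γ) (hγ : IsTame γ S C) {ι : Type*} (s : Finset ι)
    {φ : ι → ℂ → ℝ} (hφ : ∀ i ∈ s, IsTest (φ i)) (h : ∀ i ∈ s, GreenFor Ω γ (φ i) v) :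
    IsTest (fun z => ∑ i ∈ s, φ i z) ∧ GreenFor Ω γ (fun z => ∑ i ∈ s, φ i z) v := by
  classical
  induction s using Finset.induction_on with
  | empty =>
    simp only [Finset.sum_empty]
    exact ⟨⟨contDiff_const, HasCompactSupport.zero⟩, by simp [GreenFor]⟩
  | insert i s hi ih =>
    obtain ⟨h1, h2⟩ := ih (fun j hj => hφ j (Finset.mem_insert_of_mem hj))
      (fun j hj => h j (Finset.mem_insert_of_mem hj))
    simp only [Finset.sum_insert hi]
    have h3 := hφ i (Finset.mem_insert_self i s)
    exact ⟨h3.add h1, (h i (Finset.mem_insert_self i s)).add hΩ hγ h3 h1 h2⟩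

/-- Directions pointing to the left span the plane, so near a smooth point of the curve Green's
formula holds for all directions. -/
theorem IsRegion.local_green (hΩ : IsRegion Ω γ) (hγ : IsTame γ S C)
    (hs : s ∈ Ioo (0 : ℝ) 1) (hS : s ∉ S) (v : ℂ) :
    ∃ U ∈ 𝓝 (γ s), ∀ φ, IsTest φ → tsupport φ ⊆ U → GreenFor Ω γ φ v := by
  have hpos := hγ.inner_I_mul_deriv_pos hs hS
  obtain ⟨-, U₁, hU₁, h₁⟩ := hΩ.local_green_of_pos hγ hs hS hpos
  obtain ⟨-, U₂, hU₂, h₂⟩ := hΩ.local_green_of_pos (v := Complex.I * deriv γ s + deriv γ s)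
    hγ hs hS (by rwa [inner_add_left, inner_self_I_mul, add_zero])
  refine ⟨U₁ ∩ U₂, inter_mem hU₁ hU₂, fun φ hφ hsupp => ?_⟩
  have := (h₁ φ hφ (hsupp.trans inter_subset_left)).add_smul hΩ hγ hφ
    (h₂ φ hφ (hsupp.trans inter_subset_right))
    ((v / deriv γ s).im - (v / deriv γ s).re) (v / deriv γ s).re
  convert this using 1
  have hne := hγ.deriv_ne_zero s hs hS
  set q := v / deriv γ s with hq
  rw [(div_eq_iff hne).1 hq.symm, Complex.real_smul, Complex.real_smul]
  conv_lhs => rw [← Complex.re_add_im q]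
  push_cast
  ring

theorem IsRegion.local_green_of_notMem_frontier (hΩ : IsRegion Ω γ) {z : ℂ}
    (hz : z ∉ frontier Ω) (v : ℂ) :
    ∃ U ∈ 𝓝 z, ∀ φ, IsTest φ → tsupport φ ⊆ U → GreenFor Ω γ φ v := by
  obtain ⟨ε, hε, hball⟩ := Metric.mem_nhds_iff.1 (isClosed_frontier.isOpen_compl.mem_nhds hz)
  refine ⟨Metric.ball z ε, Metric.ball_mem_nhds z hε, fun φ hφ hsupp => ?_⟩
  have h0 : ∀ w ∉ Metric.ball z ε, fderiv ℝ φ w v = 0 := fun w hw =>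
    IsTest.fderiv_eq_zero v (mt (@hsupp w) hw)
  have hrhs : ∫ t in (0 : ℝ)..1, rightWeight Ω γ t *
      (φ (γ t) * inner ℝ v (-(Complex.I * deriv γ t))) = 0 := by
    rw [intervalIntegral_congr_of_finset (g := fun _ => (0 : ℝ)) zero_le_one ∅]
    · simp
    intro t ht _
    have : γ t ∉ tsupport φ := fun hc =>
      hball (hsupp hc) (hΩ.mem_frontier ⟨ht.1.le, ht.2.le⟩)
    rw [image_eq_zero_of_notMem_tsupport this]
    ring
  unfold GreenFor
  rw [hrhs]
  rcases subset_or_disjoint_of_disjoint_frontier hΩ.isOpen (convex_ball z ε).isPreconnected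
    (disjoint_left.2 fun w hw => hball hw) with h | h
  · rw [setIntegral_eq_integral_of_forall_compl_eq_zero fun w hw => h0 w (mt (@h w) hw)]
    exact hφ.integral_fderiv_eq_zero v
  · exact setIntegral_eq_zero_of_forall_eq_zero fun w hw => h0 w (disjoint_right.1 h hw)

/-- By a partition of unity Green's formula is a local statement. -/
theorem IsRegion.green_of_local (hΩ : IsRegion Ω γ) (hγ : IsTame γ S C) (hφ : IsTest φ)
    (h : ∀ z ∈ tsupport φ, ∃ U ∈ 𝓝 z, ∀ ψ, IsTest ψ → tsupport ψ ⊆ U → GreenFor Ω γ ψ v) :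
    GreenFor Ω γ φ v := by
  choose! U hU hG using h
  have hcomp : IsCompact (tsupport φ) := hφ.hasCompactSupport
  obtain ⟨F, hF, hcov⟩ := hcomp.elim_nhds_subcover (fun z => interior (U z))
    (fun z hz => interior_mem_nhds.2 (hU z hz))
  obtain ⟨f, hf⟩ := SmoothPartitionOfUnity.exists_isSubordinate (modelWithCornersSelf ℝ ℂ)
    (isClosed_tsupport φ) (fun z : F => interior (U z)) (fun _ => isOpen_interior)
    (fun z hz => by simpa using hcov hz)
  have hsum : φ = fun z => ∑ i : F, f i z * φ z := by
    ext z
    by_cases hz : z ∈ tsupport φ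
    · have := f.sum_eq_one hz
      rw [finsum_eq_sum_of_fintype] at this
      rw [← Finset.sum_mul, this, one_mul]
    · simp [image_eq_zero_of_notMem_tsupport hz]
  have htest : ∀ i : F, IsTest (fun z => f i z * φ z) := fun i =>
    hφ.mul ((contMDiff_iff_contDiff.1 (f i).contMDiff).of_le (by simp))
  rw [hsum]
  refine (GreenFor.sum hΩ hγ Finset.univ (fun i _ => htest i) fun i _ => ?_).2
  exact hG i (hF i i.2) _ (htest i)
    ((closure_mono (Function.support_mul_subset_left _ _)).trans
      ((hf i).trans interior_subset))

theorem IsRegion.green_of_disjoint_corners (hΩ : IsRegion Ω γ) (hγ : IsTame γ S C)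
    (hφ : IsTest φ) (hd : ∀ s ∈ S, γ s ∉ tsupport φ) (v : ℂ) : GreenFor Ω γ φ v := by
  refine hΩ.green_of_local hγ hφ fun z hz => ?_
  by_cases hzf : z ∈ frontier Ω
  · rw [hΩ.frontier_eq] at hzf
    obtain ⟨s, hs, rfl⟩ := hzf
    have hS : s ∉ S := fun hS => hd s hS hz
    have h0 : s ≠ 0 := fun h => hS (h ▸ hγ.zero_mem)
    have h1 : s ≠ 1 := fun h => hS (h ▸ hγ.one_mem)
    exact hΩ.local_green hγ ⟨lt_of_le_of_ne hs.1 h0.symm, lt_of_le_of_ne hs.2 h1⟩ hS v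
  · exact hΩ.local_green_of_notMem_frontier hzf v

end

/-! ### Removing the corners -/

/-- A fixed bump function around `0`. -/
noncomputable def unitBump : ContDiffBump (0 : ℂ) := ⟨1, 2, one_pos, one_lt_two⟩

/-- A smooth function that vanishes near `c` and is `1` at distance at least `2 / (n + 1)`
from `c`. -/
noncomputable def cornerCutoff (c : ℂ) (n : ℕ) (z : ℂ) : ℝ :=
  1 - unitBump (((n : ℝ) + 1) • (z - c))

theorem contDiff_cornerCutoff (c : ℂ) (n : ℕ) : ContDiff ℝ 1 (cornerCutoff c n) :=
  contDiff_const.sub (unitBump.contDiff.comp (by fun_prop))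

theorem abs_cornerCutoff_le (c : ℂ) (n : ℕ) (z : ℂ) : |cornerCutoff c n z| ≤ 1 := by
  unfold cornerCutoff
  have h1 := unitBump.nonneg (x := ((n : ℝ) + 1) • (z - c))
  have h2 := unitBump.le_one (x := ((n : ℝ) + 1) • (z - c))
  rw [abs_le]
  constructor <;> linarith

theorem norm_nat_succ_smul (n : ℕ) (z : ℂ) : ‖((n : ℝ) + 1) • z‖ = ((n : ℝ) + 1) * ‖z‖ := by
  rw [norm_smul, Real.norm_of_nonneg (by positivity)]

theorem cornerCutoff_eventuallyEq_zero (c : ℂ) (n : ℕ) : cornerCutoff c n =ᶠ[𝓝 c] 0 := by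
  have hn : (0 : ℝ) < (n : ℝ) + 1 := by positivity
  filter_upwards [Metric.closedBall_mem_nhds c (inv_pos.2 hn)] with z hz
  have : unitBump (((n : ℝ) + 1) • (z - c)) = 1 := by
    apply unitBump.one_of_mem_closedBall
    rw [mem_closedBall_zero_iff, norm_nat_succ_smul]
    rw [Metric.mem_closedBall, dist_eq_norm] at hz
    calc ((n : ℝ) + 1) * ‖z - c‖ ≤ ((n : ℝ) + 1) * ((n : ℝ) + 1)⁻¹ := by gcongr
      _ = 1 := mul_inv_cancel₀ hn.ne'
  simp only [cornerCutoff, this, sub_self, Pi.zero_apply]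

theorem tendsto_cornerCutoff {c z : ℂ} (hz : z ≠ c) :
    Tendsto (fun n => cornerCutoff c n z) atTop (𝓝 1) := by
  have hpos : 0 < ‖z - c‖ := norm_pos_iff.2 (sub_ne_zero.2 hz)
  refine tendsto_const_nhds.congr' ?_
  obtain ⟨N, hN⟩ := exists_nat_gt (2 / ‖z - c‖)
  filter_upwards [eventually_ge_atTop N] with n hn
  have : unitBump (((n : ℝ) + 1) • (z - c)) = 0 := by
    apply unitBump.zero_of_le_dist
    rw [dist_zero_right, norm_nat_succ_smul]
    have h1 : (N : ℝ) ≤ n := by exact_mod_cast hn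
    have h2 := (div_lt_iff₀ hpos).1 hN
    calc (2 : ℝ) ≤ N * ‖z - c‖ := h2.le
      _ ≤ ((n : ℝ) + 1) * ‖z - c‖ := by gcongr; linarith
  simp only [cornerCutoff, this, sub_zero]

theorem fderiv_cornerCutoff (c : ℂ) (n : ℕ) (z v : ℂ) :
    fderiv ℝ (cornerCutoff c n) z v =
      -(((n : ℝ) + 1) * fderiv ℝ unitBump (((n : ℝ) + 1) • (z - c)) v) := by
  have h1 : HasFDerivAt (fun z : ℂ => ((n : ℝ) + 1) • (z - c))
      (((n : ℝ) + 1) • ContinuousLinearMap.id ℝ ℂ) z :=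
    ((hasFDerivAt_id z).sub_const c).fun_const_smul ((n : ℝ) + 1)
  have h2 := (unitBump.contDiff.differentiable (n := 1) one_ne_zero
    (((n : ℝ) + 1) • (z - c))).hasFDerivAt.comp z h1
  have h3 : HasFDerivAt (cornerCutoff c n) _ z := h2.const_sub 1
  rw [h3.fderiv]
  simp

/-- The derivative of the cutoff grows like `n` on a disc of area like `n⁻²`. -/
theorem tendsto_integral_abs_fderiv_cornerCutoff (c v : ℂ) :
    Tendsto (fun n => ∫ z, |fderiv ℝ (cornerCutoff c n) z v|) atTop (𝓝 0) := by
  have key : ∀ n : ℕ, ∫ z, |fderiv ℝ (cornerCutoff c n) z v| =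
      (1 / ((n : ℝ) + 1)) * ∫ z, |fderiv ℝ unitBump z v| := by
    intro n
    have hn : (0 : ℝ) < (n : ℝ) + 1 := by positivity
    simp only [fderiv_cornerCutoff, abs_neg, abs_mul, abs_of_pos hn]
    rw [integral_const_mul,
      integral_sub_right_eq_self (fun z => |fderiv ℝ unitBump (((n : ℝ) + 1) • z) v|) c,
      Measure.integral_comp_smul volume (fun z => |fderiv ℝ unitBump z v|),
      Complex.finrank_real_complex, abs_of_pos (by positivity), smul_eq_mul]
    field_simp
  simp only [key]
  simpa using tendsto_one_div_add_atTop_nhds_zero_nat.mul_const (∫ z, |fderiv ℝ unitBump z v|)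

theorem isTest_unitBump : IsTest unitBump := ⟨unitBump.contDiff, unitBump.hasCompactSupport⟩

theorem integrable_abs_fderiv_cornerCutoff (c : ℂ) (n : ℕ) (v : ℂ) :
    Integrable fun z => |fderiv ℝ (cornerCutoff c n) z v| := by
  have hn : ((n : ℝ) + 1) ≠ 0 := by positivity
  have h1 : Integrable fun z => fderiv ℝ unitBump (((n : ℝ) + 1) • (z - c)) v :=
    ((isTest_unitBump.integrable v).comp_smul hn).comp_sub_right c
  simp only [fderiv_cornerCutoff]
  exact (h1.const_mul _).neg.abs

section

variable {Ω : Set ℂ} {γ : ℝ → ℂ} {S : Finset ℝ} {C : ℝ} {φ : ℂ → ℝ}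

theorem IsRegion.green_of_cutoff (hΩ : IsRegion Ω γ) (hγ : IsTame γ S C) (hφ : IsTest φ)
    (c v : ℂ) (h : ∀ n, GreenFor Ω γ (fun z => cornerCutoff c n z * φ z) v) :
    GreenFor Ω γ φ v := by
  have hlhs : Tendsto (fun n => ∫ z in Ω, fderiv ℝ (fun z => cornerCutoff c n z * φ z) z v)
      atTop (𝓝 (∫ z in Ω, fderiv ℝ φ z v)) := by
    have hsplit : ∀ n, ∫ z in Ω, fderiv ℝ (fun z => cornerCutoff c n z * φ z) z v =
        (∫ z in Ω, cornerCutoff c n z * fderiv ℝ φ z v) +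
          ∫ z in Ω, φ z * fderiv ℝ (cornerCutoff c n) z v := by
      intro n
      rw [← integral_add]
      · congr 1
        ext z
        rw [fderiv_fun_mul ((contDiff_cornerCutoff c n).differentiable one_ne_zero z)
          (hφ.differentiable z)]
        simp
      · refine ((hφ.integrable v).bdd_mul (c := 1)
          (contDiff_cornerCutoff c n).continuous.aestronglyMeasurable
          (.of_forall fun z => abs_cornerCutoff_le c n z)).integrableOn
      · obtain ⟨M, hM⟩ := hφ.exists_bound
        refine (Integrable.bdd_mul (c := M) ?_ hφ.continuous.aestronglyMeasurable
          (.of_forall hM)).integrableOn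
        refine (integrable_norm_iff ?_).1 (integrable_abs_fderiv_cornerCutoff c n v)
        exact (((contDiff_cornerCutoff c n).continuous_fderiv one_ne_zero).clm_apply
          continuous_const).aestronglyMeasurable
    simp only [hsplit]
    rw [← add_zero (∫ z in Ω, fderiv ℝ φ z v)]
    refine Tendsto.add ?_ ?_
    · refine tendsto_integral_of_dominated_convergence (fun z => ‖fderiv ℝ φ z v‖)
        (fun n => ?_) (hφ.integrable v).norm.integrableOn (fun n => .of_forall fun z => ?_) ?_
      · exact ((contDiff_cornerCutoff c n).continuous.mul
          (hφ.continuous_fderiv_apply v)).aestronglyMeasurable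
      · rw [norm_mul]
        exact mul_le_of_le_one_left (norm_nonneg _) (abs_cornerCutoff_le c n z)
      · have : ∀ᵐ z ∂(volume.restrict Ω), z ∉ ({c} : Set ℂ) :=
          measure_eq_zero_iff_ae_notMem.1 (le_antisymm
            ((Measure.restrict_apply_le _ _).trans (by simp)) bot_le)
        filter_upwards [this] with z hz
        simpa using (tendsto_cornerCutoff (show z ≠ c from hz)).mul_const (fderiv ℝ φ z v)
    · obtain ⟨M, hM⟩ := hφ.exists_bound
      refine squeeze_zero_norm (a := fun n => M * ∫ z, |fderiv ℝ (cornerCutoff c n) z v|)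
        (fun n => ?_) (by simpa using (tendsto_integral_abs_fderiv_cornerCutoff c v).const_mul M)
      have hi := integrable_abs_fderiv_cornerCutoff c n v
      have hM0 : 0 ≤ M := (norm_nonneg _).trans (hM 0)
      calc ‖∫ z in Ω, φ z * fderiv ℝ (cornerCutoff c n) z v‖
          ≤ ∫ z in Ω, M * |fderiv ℝ (cornerCutoff c n) z v| := by
            refine norm_integral_le_of_norm_le (hi.integrableOn.const_mul M)
              (.of_forall fun z => ?_)
            rw [norm_mul]
            exact mul_le_mul_of_nonneg_right (hM z) (abs_nonneg _)
        _ = M * ∫ z in Ω, |fderiv ℝ (cornerCutoff c n) z v| := integral_const_mul _ _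
        _ ≤ M * ∫ z, |fderiv ℝ (cornerCutoff c n) z v| :=
            mul_le_mul_of_nonneg_left
              (setIntegral_le_integral hi (.of_forall fun z => abs_nonneg _)) hM0
  have hrhs : Tendsto (fun n => ∫ t in (0 : ℝ)..1, rightWeight Ω γ t *
      (cornerCutoff c n (γ t) * φ (γ t) * inner ℝ v (-(Complex.I * deriv γ t)))) atTop
      (𝓝 (∫ t in (0 : ℝ)..1, rightWeight Ω γ t *
        (φ (γ t) * inner ℝ v (-(Complex.I * deriv γ t))))) := by
    refine intervalIntegral.tendsto_integral_filter_of_dominated_convergence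
      (fun t => ‖rightWeight Ω γ t * (φ (γ t) * inner ℝ v (-(Complex.I * deriv γ t)))‖)
      (.of_forall fun n => ?_) (.of_forall fun n => .of_forall fun t _ => ?_)
      (hΩ.intervalIntegrable_green hγ hφ v).norm ?_
    · exact (intervalIntegrable_iff.1 (hΩ.intervalIntegrable_green hγ
        (hφ.mul (contDiff_cornerCutoff c n)) v)).aestronglyMeasurable
    · rw [mul_assoc, mul_left_comm, norm_mul (cornerCutoff c n (γ t))]
      exact mul_le_of_le_one_left (norm_nonneg _) (abs_cornerCutoff_le c n _)
    · have hlim : ∀ t, γ t ≠ c → Tendsto (fun n => rightWeight Ω γ t *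
          (cornerCutoff c n (γ t) * φ (γ t) * inner ℝ v (-(Complex.I * deriv γ t)))) atTop
          (𝓝 (rightWeight Ω γ t * (φ (γ t) * inner ℝ v (-(Complex.I * deriv γ t))))) := by
        intro t ht
        simpa using (((tendsto_cornerCutoff ht).mul_const (φ (γ t))).mul_const
          (inner ℝ v (-(Complex.I * deriv γ t)))).const_mul (rightWeight Ω γ t)
      -- the curve passes at most once through `c`
      have hsub : ({t ∈ Ioo (0 : ℝ) 1 | γ t = c}).Subsingleton := fun t ht t' ht' =>
        hΩ.simple ⟨ht.1.1.le, ht.1.2⟩ ⟨ht'.1.1.le, ht'.1.2⟩ (ht.2.trans ht'.2.symm)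
      have := ae_restrict_uIoc_of_finset (p := fun t => Tendsto (fun n => rightWeight Ω γ t *
          (cornerCutoff c n (γ t) * φ (γ t) * inner ℝ v (-(Complex.I * deriv γ t)))) atTop
          (𝓝 (rightWeight Ω γ t * (φ (γ t) * inner ℝ v (-(Complex.I * deriv γ t))))))
        zero_le_one hsub.finite.toFinset
        fun t ht htc => hlim t fun he => htc (by simpa using ⟨ht, he⟩)
      rwa [ae_restrict_iff' measurableSet_uIoc] at this
  refine tendsto_nhds_unique hlhs (hrhs.congr fun n => ?_)
  exact (h n).symm

/-- Green's formula for `Ω`, up to the weight of its boundary. -/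
theorem IsRegion.green (hΩ : IsRegion Ω γ) (hγ : IsTame γ S C) (hφ : IsTest φ) (v : ℂ) :
    GreenFor Ω γ φ v := by
  classical
  have key : ∀ F : Finset ℂ,
      (∀ φ, IsTest φ → (∀ c ∈ F, c ∉ tsupport φ) → GreenFor Ω γ φ v) →
      ∀ φ, IsTest φ → GreenFor Ω γ φ v := by
    intro F
    induction F using Finset.induction_on with
    | empty => intro h φ hφ; exact h φ hφ (by simp)
    | insert c F _ ih =>
      intro h
      refine ih fun φ hφ hF => hΩ.green_of_cutoff hγ hφ c v fun n => ?_
      refine h _ (hφ.mul (contDiff_cornerCutoff c n)) fun d hd => ?_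
      rcases Finset.mem_insert.1 hd with rfl | hd
      · rw [notMem_tsupport_iff_eventuallyEq]
        filter_upwards [cornerCutoff_eventuallyEq_zero d n] with z hz
        simp [hz]
      · exact fun hc => hF d hd (closure_mono (Function.support_mul_subset_right _ _) hc)
  refine key (S.image γ) (fun φ hφ hd => ?_) φ hφ
  exact hΩ.green_of_disjoint_corners hγ hφ (fun s hs => hd _ (Finset.mem_image_of_mem γ hs)) v

end

/-! ### The area as a boundary integral -/

theorem eq_of_eventually_eq {f : ℝ → ℝ} {a b : ℝ}
    (h : ∀ s ∈ Ioo a b, ∀ᶠ t in 𝓝 s, f t = f s) {x y : ℝ} (hx : x ∈ Ioo a b) (hy : y ∈ Ioo a b) :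
    f x = f y := by
  have hd : ∀ s ∈ Ioo a b, HasDerivAt f 0 s := fun s hs =>
    (hasDerivAt_const s (f s)).congr_of_eventuallyEq (h s hs)
  exact isOpen_Ioo.is_const_of_deriv_eq_zero isPreconnected_Ioo
    (fun s hs => (hd s hs).differentiableAt.differentiableWithinAt)
    (fun s hs => (hd s hs).deriv) hx hy

section

variable {Ω : Set ℂ} {γ : ℝ → ℂ} {S : Finset ℝ} {C : ℝ} {s : ℝ}

theorem IsTame.hasDerivAt_comp (hγ : IsTame γ S C) {ψ : ℂ → ℝ} (hψ : IsTest ψ)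
    (hs : s ∈ Ioo (0 : ℝ) 1) (hS : s ∉ S) :
    HasDerivAt (fun t => ψ (γ t)) (fderiv ℝ ψ (γ s) (deriv γ s)) s :=
  (hψ.differentiable (γ s)).hasFDerivAt.comp_hasDerivAt s (hγ.hasDerivAt hs hS)

theorem IsTame.intervalIntegrable_comp (hγ : IsTame γ S C) {ψ : ℂ → ℝ} (hψ : IsTest ψ) :
    IntervalIntegrable (fun t => fderiv ℝ ψ (γ t) (deriv γ t)) volume 0 1 := by
  have hsplit : ∀ z w : ℂ, fderiv ℝ ψ z w =
      inner ℝ ((fderiv ℝ ψ z 1 : ℂ) + (fderiv ℝ ψ z Complex.I) * Complex.I) w := by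
    intro z w
    conv_lhs => rw [← Complex.re_add_im w, ← mul_one (w.re : ℂ), ← Complex.real_smul,
      ← Complex.real_smul, map_add, map_smul, map_smul]
    simp [Complex.inner]
  rw [funext fun t => hsplit (γ t) (deriv γ t)]
  refine hγ.intervalIntegrable_inner ?_
  refine (Complex.continuous_ofReal.comp_continuousOn ?_).add
    ((Complex.continuous_ofReal.comp_continuousOn ?_).mul continuousOn_const) <;>
  exact (hψ.continuous_fderiv_apply _).comp_continuousOn hγ.continuousOn

/-- The curve with the weight `rightWeight` has no boundary in the sense of currents: this is
Green's formula for the divergence-free field with stream function `ψ`. -/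
theorem IsRegion.integral_rightWeight_mul_deriv_comp (hΩ : IsRegion Ω γ) (hγ : IsTame γ S C)
    {ψ : ℂ → ℝ} (hψ : ContDiff ℝ 2 ψ) (hc : HasCompactSupport ψ) :
    ∫ t in (0 : ℝ)..1, rightWeight Ω γ t * fderiv ℝ ψ (γ t) (deriv γ t) = 0 := by
  have hd : ContDiff ℝ 1 (fderiv ℝ ψ) := hψ.fderiv_right (by norm_num)
  have htest : ∀ w : ℂ, IsTest fun z => fderiv ℝ ψ z w := fun w =>
    ⟨hd.clm_apply contDiff_const, hc.fderiv_apply ℝ w⟩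
  have hsnd : ∀ z w v : ℂ, fderiv ℝ (fun z => fderiv ℝ ψ z w) z v =
      fderiv ℝ (fderiv ℝ ψ) z v w := by
    intro z w v
    have := ((hd.differentiable one_ne_zero z).hasFDerivAt).clm_apply (hasFDerivAt_const w z)
    rw [this.fderiv]
    simp
  have hsymm : ∀ z, fderiv ℝ (fderiv ℝ ψ) z 1 Complex.I = fderiv ℝ (fderiv ℝ ψ) z Complex.I 1 :=
    fun z => (hψ.contDiffAt.isSymmSndFDerivAt (by simp)).eq 1 Complex.I
  have h1 := hΩ.green hγ (htest Complex.I) 1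
  have h2 := hΩ.green hγ (htest 1) Complex.I
  unfold GreenFor at h1 h2
  simp only [hsnd] at h1 h2
  simp only [hsymm] at h1
  rw [h1] at h2
  rw [← sub_eq_zero, ← intervalIntegral.integral_sub
    (hΩ.intervalIntegrable_green hγ (htest Complex.I) 1)
    (hΩ.intervalIntegrable_green hγ (htest 1) Complex.I)] at h2
  rw [← h2]
  congr 1
  ext t
  have : fderiv ℝ ψ (γ t) (deriv γ t) = (deriv γ t).re * fderiv ℝ ψ (γ t) 1 +
      (deriv γ t).im * fderiv ℝ ψ (γ t) Complex.I := by
    conv_lhs => rw [← Complex.re_add_im (deriv γ t), ← mul_one ((deriv γ t).re : ℂ),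
      ← Complex.real_smul, ← Complex.real_smul, map_add, map_smul, map_smul]
    rfl
  rw [this]
  simp [Complex.inner]
  ring

/-- The weight is the same on both sides of a corner. -/
theorem IsRegion.exists_eventually_rightWeight_eq (hΩ : IsRegion Ω γ) (hγ : IsTame γ S C)
    (hs : s ∈ Ioo (0 : ℝ) 1) : ∃ a, ∀ᶠ t in 𝓝[≠] s, rightWeight Ω γ t = a := by
  classical
  have hev : ∀ᶠ t in 𝓝 s, t ∈ Ioo (0 : ℝ) 1 ∧ t ∉ S.erase s :=
    Filter.Eventually.and (isOpen_Ioo.mem_nhds hs)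
      ((S.erase s).finite_toSet.isClosed.isOpen_compl.mem_nhds (by simp))
  obtain ⟨δ, hδ, hball⟩ := Metric.eventually_nhds_iff_ball.1 hev
  rw [Real.ball_eq_Ioo] at hball
  have hlc : ∀ t ∈ Ioo (s - δ) (s + δ), t ≠ s →
      ∀ᶠ u in 𝓝 t, rightWeight Ω γ u = rightWeight Ω γ t := fun t ht hts =>
    hΩ.eventually_rightWeight_eq hγ (hball t ht).1 fun hS =>
      (hball t ht).2 (Finset.mem_erase.2 ⟨hts, hS⟩)
  set a := rightWeight Ω γ (s - δ / 2)
  set b := rightWeight Ω γ (s + δ / 2)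
  have ha : ∀ t ∈ Ioo (s - δ) s, rightWeight Ω γ t = a := fun t ht =>
    eq_of_eventually_eq (fun u hu => hlc u ⟨hu.1, by linarith [hu.2]⟩ hu.2.ne) ht
      ⟨by linarith, by linarith⟩
  have hb : ∀ t ∈ Ioo s (s + δ), rightWeight Ω γ t = b := fun t ht =>
    eq_of_eventually_eq (fun u hu => hlc u ⟨by linarith [hu.1], hu.2⟩ hu.1.ne') ht
      ⟨by linarith, by linarith⟩
  -- a bump function at `γ s` that does not see the rest of the curve
  have hK : IsCompact (γ '' (Icc 0 1 \ Ioo (s - δ) (s + δ))) :=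
    (isCompact_Icc.diff isOpen_Ioo).image_of_continuousOn (hγ.continuousOn.mono sdiff_subset)
  have hsK : γ s ∉ γ '' (Icc 0 1 \ Ioo (s - δ) (s + δ)) := by
    rintro ⟨t, ht, he⟩
    rw [hΩ.eq_of_apply_eq hs ht.1 he] at ht
    exact ht.2 ⟨by linarith, by linarith⟩
  obtain ⟨η, hη, hηK⟩ := Metric.mem_nhds_iff.1 (hK.isClosed.isOpen_compl.mem_nhds hsK)
  let ψ : ContDiffBump (γ s) := ⟨η / 4, η / 2, by linarith, by linarith⟩
  have hψt : IsTest ψ := ⟨ψ.contDiff, ψ.hasCompactSupport⟩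
  have hψK : ∀ t ∈ Icc (0 : ℝ) 1, t ∉ Ioo (s - δ) (s + δ) → γ t ∉ tsupport ψ := by
    intro t ht hto hts
    rw [ψ.tsupport_eq] at hts
    refine hηK ?_ ⟨t, ⟨ht, hto⟩, rfl⟩
    exact Metric.closedBall_subset_ball (show η / 2 < η by linarith) hts
  have hψs : ψ (γ s) = 1 := ψ.one_of_mem_closedBall (Metric.mem_closedBall_self (by positivity))
  -- the end points of the curve are not seen
  have hn0 : (0 : ℝ) ∉ Ioo (s - δ) (s + δ) := fun h => lt_irrefl _ (hball 0 h).1.1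
  have hn1 : (1 : ℝ) ∉ Ioo (s - δ) (s + δ) := fun h => lt_irrefl _ (hball 1 h).1.2
  have hψ0 : ψ (γ 0) = 0 := image_eq_zero_of_notMem_tsupport (hψK 0 (by simp) hn0)
  have hψ1 : ψ (γ 1) = 0 := image_eq_zero_of_notMem_tsupport (hψK 1 (by simp) hn1)
  have hint := hΩ.integral_rightWeight_mul_deriv_comp hγ (ψ.contDiff (n := 2)) ψ.hasCompactSupport
  have hi := hγ.intervalIntegrable_comp hψt
  have h0s : uIcc 0 s ⊆ uIcc (0 : ℝ) 1 := by
    rw [uIcc_of_le hs.1.le, uIcc_of_le zero_le_one]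
    exact Icc_subset_Icc_right hs.2.le
  have hs1 : uIcc s 1 ⊆ uIcc (0 : ℝ) 1 := by
    rw [uIcc_of_le hs.2.le, uIcc_of_le zero_le_one]
    exact Icc_subset_Icc_left hs.1.le
  have hcomp : ContinuousOn (fun t => ψ (γ t)) (Icc 0 1) :=
    hψt.continuous.comp_continuousOn hγ.continuousOn
  have hA : ∫ t in (0 : ℝ)..s, rightWeight Ω γ t * fderiv ℝ ψ (γ t) (deriv γ t) = a := by
    rw [intervalIntegral_congr_of_finset (g := fun t => a * fderiv ℝ ψ (γ t) (deriv γ t)) hs.1.le ∅,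
      intervalIntegral.integral_const_mul,
      integral_eq_of_hasDerivAt_off_countable_of_le (fun t => ψ (γ t)) _ hs.1.le S.countable_toSet
        (hcomp.mono (Icc_subset_Icc_right hs.2.le)) (fun t ht => hγ.hasDerivAt_comp hψt
          ⟨ht.1.1, ht.1.2.trans hs.2⟩ ht.2) (hi.mono_set h0s), hψs, hψ0]
    · ring
    · intro t ht _
      by_cases h : s - δ < t
      · rw [ha t ⟨h, ht.2⟩]
      · rw [IsTest.fderiv_eq_zero _ (hψK t ⟨ht.1.le, (ht.2.trans hs.2).le⟩ fun hc => h hc.1)]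
        ring
  have hB : ∫ t in s..1, rightWeight Ω γ t * fderiv ℝ ψ (γ t) (deriv γ t) = -b := by
    rw [intervalIntegral_congr_of_finset (g := fun t => b * fderiv ℝ ψ (γ t) (deriv γ t)) hs.2.le ∅,
      intervalIntegral.integral_const_mul,
      integral_eq_of_hasDerivAt_off_countable_of_le (fun t => ψ (γ t)) _ hs.2.le S.countable_toSet
        (hcomp.mono (Icc_subset_Icc_left hs.1.le)) (fun t ht => hγ.hasDerivAt_comp hψt
          ⟨hs.1.trans ht.1.1, ht.1.2⟩ ht.2) (hi.mono_set hs1), hψs, hψ1]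
    · ring
    · intro t ht _
      by_cases h : t < s + δ
      · rw [hb t ⟨ht.1, h⟩]
      · rw [IsTest.fderiv_eq_zero _ (hψK t ⟨(hs.1.trans ht.1).le, ht.2.le⟩ fun hc => h hc.2)]
        ring
  have hwi : IntervalIntegrable
      (fun t => rightWeight Ω γ t * fderiv ℝ ψ (γ t) (deriv γ t)) volume 0 1 := by
    rw [intervalIntegrable_iff] at hi ⊢
    exact hi.bdd_mul (c := 1) (hΩ.aestronglyMeasurable_rightWeight hγ)
      (.of_forall (norm_rightWeight_le Ω γ))
  rw [← intervalIntegral.integral_add_adjacent_intervals (hwi.mono_set h0s) (hwi.mono_set hs1),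
    hA, hB] at hint
  have hab : a = b := by linarith
  refine ⟨a, ?_⟩
  filter_upwards [nhdsWithin_le_nhds (isOpen_Ioo.mem_nhds
    (show s ∈ Ioo (s - δ) (s + δ) from ⟨by linarith, by linarith⟩)), self_mem_nhdsWithin]
    with t ht hts
  rcases lt_or_gt_of_ne hts with h | h
  · exact ha t ⟨ht.1, h⟩
  · rw [hab]
    exact hb t ⟨h, ht.2⟩

theorem IsRegion.exists_rightWeight_eq (hΩ : IsRegion Ω γ) (hγ : IsTame γ S C) :
    ∃ a, ∀ t ∈ Ioo (0 : ℝ) 1, t ∉ S → rightWeight Ω γ t = a := by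
  choose! W hW using fun s (hs : s ∈ Ioo (0 : ℝ) 1) => hΩ.exists_eventually_rightWeight_eq hγ hs
  have hlc : ∀ s ∈ Ioo (0 : ℝ) 1, ∀ᶠ t in 𝓝 s, W t = W s := by
    intro s hs
    have h1 := eventually_nhdsWithin_iff.1 (hW s hs)
    filter_upwards [h1.eventually_nhds, isOpen_Ioo.mem_nhds hs] with t ht hts
    by_cases hne : t = s
    · rw [hne]
    obtain ⟨u, hu1, hu2, hu3⟩ := ((ht.filter_mono nhdsWithin_le_nhds).and ((hW t hts).and
      (nhdsWithin_le_nhds (isOpen_ne.mem_nhds hne)))).exists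
    rw [← hu2, hu1 hu3]
  refine ⟨W (1 / 2), fun t ht hS => ?_⟩
  rw [← eq_of_eventually_eq hlc ht (by norm_num)]
  obtain ⟨u, hu1, hu2⟩ := ((hW t ht).and
    (nhdsWithin_le_nhds (hΩ.eventually_rightWeight_eq hγ ht hS))).exists
  rw [← hu1, hu2]

theorem IsRegion.nonempty (hΩ : IsRegion Ω γ) : Ω.Nonempty := by
  by_contra h
  have := hΩ.mem_frontier (t := 0) (by simp)
  rw [not_nonempty_iff_eq_empty.1 h] at this
  simp at this

theorem IsRegion.area_pos (hΩ : IsRegion Ω γ) : 0 < area Ω :=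
  ENNReal.toReal_pos (hΩ.isOpen.measure_pos volume hΩ.nonempty).ne'
    hΩ.isBounded.measure_lt_top.ne

theorem IsRegion.area_mul (hΩ : IsRegion Ω γ) (hγ : IsTame γ S C) (L : ℂ →L[ℝ] ℝ) (v : ℂ) :
    area Ω * L v = ∫ t in (0 : ℝ)..1, rightWeight Ω γ t *
      (L (γ t) * inner ℝ v (-(Complex.I * deriv γ t))) := by
  obtain ⟨R, hR0, hR⟩ := hΩ.isBounded.closure.subset_ball_lt 0 0
  let χ : ContDiffBump (0 : ℂ) := ⟨R, R + 1, hR0, by linarith⟩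
  have htest : IsTest (fun z => L z * χ z) :=
    IsTest.mul ⟨χ.contDiff, χ.hasCompactSupport⟩ L.contDiff
  have hloc : ∀ z ∈ closure Ω, (fun z => L z * χ z) =ᶠ[𝓝 z] L := by
    intro z hz
    filter_upwards [Metric.isOpen_ball.mem_nhds (hR hz)] with w hw
    rw [χ.one_of_mem_closedBall (Metric.ball_subset_closedBall hw), mul_one]
  have hgreen := hΩ.green hγ htest v
  unfold GreenFor at hgreen
  rw [setIntegral_congr_fun (g := fun _ => L v) hΩ.isOpen.measurableSet] at hgreen
  · rw [setIntegral_const, smul_eq_mul] at hgreen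
    refine hgreen.trans (intervalIntegral_congr_of_finset zero_le_one ∅ fun t ht _ => ?_)
    beta_reduce
    have := (hloc (γ t) (frontier_subset_closure
      (hΩ.mem_frontier ⟨ht.1.le, ht.2.le⟩))).eq_of_nhds
    rw [this]
  · intro z hz
    simp only [(hloc z (subset_closure hz)).fderiv_eq, ContinuousLinearMap.fderiv]

/-- The area of a region is the oriented area enclosed by its boundary. -/
theorem IsRegion.area_eq (hΩ : IsRegion Ω γ) (hγ : IsTame γ S C) : area Ω = orientedArea γ := by
  obtain ⟨a, ha⟩ := hΩ.exists_rightWeight_eq hγ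
  have hre : IntervalIntegrable (fun t => (γ t).re * (deriv γ t).im) volume 0 1 := by
    have := hγ.intervalIntegrable_inner (u := fun t => ((γ t).re : ℂ) * Complex.I)
      ((Complex.continuous_ofReal.comp_continuousOn
        (Complex.continuous_re.comp_continuousOn hγ.continuousOn)).mul continuousOn_const)
    simpa [Complex.inner, mul_comm] using this
  have him : IntervalIntegrable (fun t => (γ t).im * (deriv γ t).re) volume 0 1 := by
    have := hγ.intervalIntegrable_inner (u := fun t => ((γ t).im : ℂ))
      (Complex.continuous_ofReal.comp_continuousOn
        (Complex.continuous_im.comp_continuousOn hγ.continuousOn))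
    simpa [Complex.inner, mul_comm] using this
  have h1 := hΩ.area_mul hγ Complex.reCLM 1
  have h2 := hΩ.area_mul hγ Complex.imCLM Complex.I
  rw [intervalIntegral_congr_of_finset (g := fun t => a * ((γ t).re * (deriv γ t).im))
    zero_le_one S fun t ht hS => by rw [ha t ht hS]; simp [Complex.inner],
    intervalIntegral.integral_const_mul] at h1
  rw [intervalIntegral_congr_of_finset (g := fun t => -a * ((γ t).im * (deriv γ t).re))
    zero_le_one S fun t ht hS => by rw [ha t ht hS]; simp [Complex.inner],
    intervalIntegral.integral_const_mul] at h2
  simp only [Complex.reCLM_apply, Complex.one_re, Complex.imCLM_apply, Complex.I_im,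
    mul_one] at h1 h2
  have h3 : area Ω = a * orientedArea γ := by
    rw [orientedArea, intervalIntegral.integral_sub hre him]
    linarith
  -- the weight is `0` or `1`, and `0` is excluded since `Ω` is not empty
  have ha1 : a = 1 := by
    obtain ⟨t, ht, hS⟩ := ((Ioo_infinite (zero_lt_one' ℝ)).sdiff S.finite_toSet).nonempty
    have hat := ha t ht hS
    have hpos := hΩ.area_pos
    unfold rightWeight at hat
    split_ifs at hat
    · rw [h3, ← hat, zero_mul] at hpos
      exact absurd hpos (lt_irrefl _)
    · exact hat.symm
  rw [h3, ha1, one_mul]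

end

/-! ### Limits of closed tractrices -/

section

variable {ℓ : ℝ} {γ : ℝ → ℂ} {θ : ℝ → ℝ} {S T : Finset ℝ} {C : ℝ}

theorem uIcc_subset_uIcc_zero_one {a b : ℝ} (ha : a ∈ Icc (0 : ℝ) 1) (hb : b ∈ Icc (0 : ℝ) 1) :
    uIcc a b ⊆ uIcc (0 : ℝ) 1 := by
  rw [← uIcc_of_le zero_le_one] at ha hb
  exact uIcc_subset_uIcc ha hb

theorem norm_angularVelocity_le {ε : ℝ} (hε : 0 < ε) (hℓ : ε ≤ ℓ) (hγ : IsTame γ S C)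
    (θ : ℝ → ℝ) {t : ℝ} (ht : t ∈ Ioo (0 : ℝ) 1) (hS : t ∉ S) :
    ‖angularVelocity ℓ γ θ t‖ ≤ ε⁻¹ * C := by
  refine (norm_inner_le_norm _ _).trans ?_
  rw [norm_smul, norm_rodNormal, mul_one, Real.norm_of_nonneg (inv_nonneg.2 (hε.le.trans hℓ))]
  exact mul_le_mul (inv_anti₀ hε hℓ) (hγ.norm_deriv_le t ht hS) (norm_nonneg _)
    (inv_nonneg.2 hε.le)

theorem SolvesPlanimeter.sub_eq_integral (hγ : IsTame γ S C) (h : SolvesPlanimeter ℓ γ θ T)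
    {a b : ℝ} (ha : 0 ≤ a) (hab : a ≤ b) (hb : b ≤ 1) :
    θ b - θ a = ∫ t in a..b, angularVelocity ℓ γ θ t :=
  (integral_eq_of_hasDerivAt_off_countable_of_le θ _ hab T.countable_toSet
    (h.continuousOn.mono (Icc_subset_Icc ha hb))
    (fun t ht => h.hasDerivAt t ⟨ha.trans_lt ht.1.1, ht.1.2.trans_le hb⟩ ht.2)
    ((intervalIntegrable_angularVelocity ℓ hγ h.continuousOn).mono_set
      (uIcc_subset_uIcc_zero_one ⟨ha, hab.trans hb⟩ ⟨ha.trans hab, hb⟩))).symm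

theorem SolvesPlanimeter.abs_sub_le {ε : ℝ} (hε : 0 < ε) (hℓ : ε ≤ ℓ) (hγ : IsTame γ S C)
    (h : SolvesPlanimeter ℓ γ θ T) {a b : ℝ} (ha : a ∈ Icc (0 : ℝ) 1) (hb : b ∈ Icc (0 : ℝ) 1) :
    |θ a - θ b| ≤ ε⁻¹ * C * |a - b| := by
  wlog hab : a ≤ b generalizing a b
  · rw [abs_sub_comm, abs_sub_comm a]
    exact this hb ha (le_of_not_ge hab)
  rw [abs_sub_comm, abs_sub_comm a, h.sub_eq_integral hγ ha.1 hab hb.2, ← Real.norm_eq_abs]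
  refine intervalIntegral.norm_integral_le_of_norm_le_const_ae ?_
  have := ae_restrict_uIoc_of_finset hab S fun t ht hS => norm_angularVelocity_le hε hℓ hγ θ
    ⟨ha.1.trans_lt ht.1, ht.2.trans_le hb.2⟩ hS
  rwa [ae_restrict_iff' measurableSet_uIoc] at this

/-- The planimeter equation is invariant under full turns of the rod. -/
theorem SolvesPlanimeter.add_int_mul_two_pi (h : SolvesPlanimeter ℓ γ θ T) (k : ℤ) :
    SolvesPlanimeter ℓ γ (fun t => θ t + k * (2 * Real.pi)) T := by
  refine ⟨h.continuousOn.add continuousOn_const, fun t ht hT => ?_⟩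
  simp only [angularVelocity, rodNormal_add_int_mul_two_pi]
  exact (h.hasDerivAt t ht hT).add_const _

/-- A continuous solution of the integral equation solves the differential equation at the smooth
points of the curve. -/
theorem SolvesPlanimeter.of_integral_eq (hγ : IsTame γ S C) (hθ : Continuous θ)
    (h : ∀ t ∈ Icc (0 : ℝ) 1, θ t - θ 0 = ∫ u in (0 : ℝ)..t, angularVelocity ℓ γ θ u) :
    SolvesPlanimeter ℓ γ θ S := by
  refine ⟨hθ.continuousOn, fun t ht hS => ?_⟩
  have hi := (intervalIntegrable_angularVelocity ℓ hγ hθ.continuousOn).mono_set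
    (uIcc_subset_uIcc_zero_one (a := 0) (b := t) (by simp) ⟨ht.1.le, ht.2.le⟩)
  have hc : ContinuousAt (angularVelocity ℓ γ θ) t :=
    (((continuous_rodNormal.comp hθ).const_smul ℓ⁻¹).continuousAt).inner
      (hγ.continuousAt_deriv ht hS)
  have hm : StronglyMeasurableAtFilter (angularVelocity ℓ γ θ) (𝓝 t) := by
    refine ⟨univ, univ_mem, ?_⟩
    exact (((continuous_rodNormal.comp hθ).const_smul ℓ⁻¹).stronglyMeasurable.inner
      (stronglyMeasurable_deriv γ)).aestronglyMeasurable
  have hd := (intervalIntegral.integral_hasDerivAt_right hi hm hc).add_const (θ 0)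
  refine hd.congr_of_eventuallyEq ?_
  filter_upwards [isOpen_Ioo.mem_nhds ht] with u hu
  rw [← h u ⟨hu.1.le, hu.2.le⟩, sub_add_cancel]

/-- Solutions for rods whose lengths converge to a positive limit have a subsequence that converges
uniformly, after full turns of the rods, to a solution for the limit. -/
theorem exists_solvesPlanimeter_of_tendsto (hγ : IsTame γ S C) (hℓ : 0 < ℓ) {l : ℕ → ℝ}
    (hl : Tendsto l atTop (𝓝 ℓ)) {ε : ℝ} (hε : 0 < ε) (hεl : ∀ n, ε ≤ l n) {θ : ℕ → ℝ → ℝ}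
    {T : ℕ → Finset ℝ} (hθ : ∀ n, SolvesPlanimeter (l n) γ (θ n) (T n)) {ω : ℝ}
    (hω : ∀ n, θ n 1 - θ n 0 = ω) :
    ∃ φ : ℝ → ℝ, SolvesPlanimeter ℓ γ φ S ∧ φ 1 - φ 0 = ω := by
  have hper : 0 < 2 * Real.pi := Real.two_pi_pos
  have hk : ∀ n, ∃ k : ℤ, θ n 0 + k * (2 * Real.pi) ∈ Ico 0 (2 * Real.pi) := fun n => by
    obtain ⟨k, hk, -⟩ := existsUnique_add_zsmul_mem_Ico hper (θ n 0) 0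
    exact ⟨k, by simpa using hk⟩
  choose k hk using hk
  set η : ℕ → ℝ → ℝ := fun n t => θ n t + k n * (2 * Real.pi) with hη
  have hsol : ∀ n, SolvesPlanimeter (l n) γ (η n) (T n) := fun n => (hθ n).add_int_mul_two_pi _
  have hηω : ∀ n, η n 1 - η n 0 = ω := fun n => by simp [hη, hω]
  set K := ε⁻¹ * C with hK
  have hlip : ∀ n, ∀ a ∈ Icc (0 : ℝ) 1, ∀ b ∈ Icc (0 : ℝ) 1, |η n a - η n b| ≤ K * |a - b| :=
    fun n a ha b hb => (hsol n).abs_sub_le hε (hεl n) hγ ha hb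
  have hK0 : 0 ≤ K := by
    have := (abs_nonneg _).trans (hlip 0 1 (by simp) 0 (by simp))
    simpa using this
  let f : ℕ → BoundedContinuousFunction (Icc (0 : ℝ) 1) ℝ := fun n =>
    BoundedContinuousFunction.mkOfCompact
      ⟨fun t => η n t, continuousOn_iff_continuous_domRestrict.1 (hsol n).continuousOn⟩
  have hf : ∀ n (t : Icc (0 : ℝ) 1), f n t = η n t := fun _ _ => rfl
  have hcomp : IsCompact (closure (range f)) := by
    refine BoundedContinuousFunction.arzela_ascoli (Icc (-K) (2 * Real.pi + K))
      isCompact_Icc _ ?_ ?_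
    · rintro _ t ⟨n, rfl⟩
      have h1 := hlip n t t.2 0 (by simp)
      have h2 : K * |(t : ℝ) - 0| ≤ K := by
        rw [sub_zero, abs_of_nonneg t.2.1]
        exact mul_le_of_le_one_right hK0 t.2.2
      have h3 := abs_le.1 (h1.trans h2)
      have h4 := hk n
      rw [hf]
      have h5 : η n 0 = θ n 0 + k n * (2 * Real.pi) := rfl
      rw [← h5] at h4
      exact ⟨by linarith [h4.1], by linarith [h4.2]⟩
    · refine (LipschitzWith.uniformEquicontinuous _ ⟨K, hK0⟩ ?_).equicontinuous
      rintro ⟨_, n, rfl⟩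
      refine LipschitzWith.of_dist_le_mul fun a b => ?_
      exact hlip n a a.2 b b.2
  obtain ⟨g, -, σ, hσ, hg⟩ := hcomp.tendsto_subseq fun n => subset_closure (mem_range_self n)
  set φ : ℝ → ℝ := fun t => g (projIcc 0 1 zero_le_one t) with hφ
  have hφc : Continuous φ := g.continuous.comp continuous_projIcc
  have hlim : ∀ t ∈ Icc (0 : ℝ) 1, Tendsto (fun n => η (σ n) t) atTop (𝓝 (φ t)) := by
    intro t ht
    have := ((continuous_eval_const (F := BoundedContinuousFunction (Icc (0 : ℝ) 1) ℝ)
      ⟨t, ht⟩).tendsto g).comp hg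
    simp only [hφ, projIcc_of_mem zero_le_one ht]
    exact this
  have hlσ : Tendsto (fun n => l (σ n)) atTop (𝓝 ℓ) := hl.comp hσ.tendsto_atTop
  have hint : ∀ t ∈ Icc (0 : ℝ) 1, φ t - φ 0 = ∫ u in (0 : ℝ)..t, angularVelocity ℓ γ φ u := by
    intro t ht
    have h1 : Tendsto (fun n => η (σ n) t - η (σ n) 0) atTop (𝓝 (φ t - φ 0)) :=
      (hlim t ht).sub (hlim 0 (by simp))
    refine tendsto_nhds_unique h1 ?_
    simp only [fun n => (hsol (σ n)).sub_eq_integral hγ le_rfl ht.1 ht.2]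
    refine intervalIntegral.tendsto_integral_filter_of_dominated_convergence (fun _ => K)
      (.of_forall fun n => ?_) (.of_forall fun n => ?_) intervalIntegrable_const ?_
    · exact (intervalIntegrable_iff.1 ((intervalIntegrable_angularVelocity (l (σ n)) hγ
        (hsol (σ n)).continuousOn).mono_set
        (uIcc_subset_uIcc_zero_one (by simp) ht))).aestronglyMeasurable
    · have := ae_restrict_uIoc_of_finset ht.1 S fun u hu hS =>
        norm_angularVelocity_le hε (hεl (σ n)) hγ (η (σ n)) ⟨hu.1, hu.2.trans_le ht.2⟩ hS
      rwa [ae_restrict_iff' measurableSet_uIoc] at this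
    · refine .of_forall fun u hu => ?_
      rw [uIoc_of_le ht.1] at hu
      have h2 := (continuous_rodNormal.tendsto _).comp (hlim u ⟨hu.1.le, hu.2.trans ht.2⟩)
      exact ((hlσ.inv₀ hℓ.ne').smul h2).inner tendsto_const_nhds
  refine ⟨φ, .of_integral_eq hγ hφc hint, ?_⟩
  refine tendsto_nhds_unique ((hlim 1 (by simp)).sub (hlim 0 (by simp))) ?_
  simp only [hηω]
  exact tendsto_const_nhds

theorem SolvesPlanimeter.isClosedTractrix (hℓ : 0 < ℓ) (hγ : IsTame γ S C)
    (h : SolvesPlanimeter ℓ γ θ T) (h01 : γ 0 = γ 1) (hrot : θ 1 - θ 0 = 2 * Real.pi) :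
    IsClosedTractrixOneRotation ℓ γ θ := by
  refine ⟨h.isPlanimeterMotion hℓ hγ, ?_, hrot⟩
  unfold chisel
  rw [h01, sub_eq_iff_eq_add.1 hrot]
  push_cast
  rw [add_mul, Complex.exp_add, Complex.exp_two_pi_mul_I, one_mul]

/-- The limiting case of Menzin's conjecture. -/
theorem MenzinFor.exists_of_area_eq {Ω : Set ℂ} (hM : MenzinFor Ω γ) (hγ : IsTame γ S C)
    (h01 : γ 0 = γ 1) (hℓ : 0 < ℓ) (hA : area Ω = Real.pi * ℓ ^ 2) :
    ∃ θ, IsClosedTractrixOneRotation ℓ γ θ := by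
  set l : ℕ → ℝ := fun n => ℓ * (1 - 1 / (n + 2)) with hl
  have hbd : ∀ n : ℕ, 0 < (1 : ℝ) / (n + 2) ∧ (1 : ℝ) / (n + 2) ≤ 1 / 2 := fun n =>
    ⟨by positivity, one_div_le_one_div_of_le two_pos (by linarith [n.cast_nonneg (α := ℝ)])⟩
  have hlow : ∀ n, ℓ / 2 ≤ l n := fun n => by
    have := mul_le_mul_of_nonneg_left (hbd n).2 hℓ.le
    simp only [hl]
    linarith
  have hlt : ∀ n, l n < ℓ := fun n => by
    have := mul_pos hℓ (hbd n).1
    simp only [hl]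
    linarith
  have hlim : Tendsto l atTop (𝓝 ℓ) := by
    have h1 : Tendsto (fun n : ℕ => (1 : ℝ) / (n + 2)) atTop (𝓝 0) := by
      have := (tendsto_one_div_add_atTop_nhds_zero_nat (𝕜 := ℝ)).comp (tendsto_add_atTop_nat 1)
      refine this.congr fun n => ?_
      simp only [Function.comp]
      push_cast
      ring
    have := (h1.const_sub 1).const_mul ℓ
    rwa [sub_zero, mul_one] at this
  have hpos : ∀ n, 0 < l n := fun n => (half_pos hℓ).trans_le (hlow n)
  have hex : ∀ n, ∃ θ : ℝ → ℝ, IsClosedTractrixOneRotation (l n) γ θ := fun n => by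
    refine hM (l n) (hpos n) ?_
    rw [hA]
    have := pow_lt_pow_left₀ (hlt n) (hpos n).le two_ne_zero
    exact mul_lt_mul_of_pos_left this Real.pi_pos
  choose θ hθ using hex
  choose T hT using fun n => (hθ n).1.exists_solves (hpos n)
  obtain ⟨φ, h1, h2⟩ := exists_solvesPlanimeter_of_tendsto hγ hℓ hlim (half_pos hℓ) hlow hT
    fun n => (hθ n).2.2
  exact ⟨φ, h1.isClosedTractrix hℓ hγ h01 h2⟩

/-! ### The case of equality -/

/-- If the roll of the tracer wheel is the whole length of the curve, then the curve is everywhere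
normal to the rod, so the chisel point does not move. -/
theorem SolvesPlanimeter.chisel_eq (hℓ : 0 < ℓ) (hγ : IsTame γ S C) (h : SolvesPlanimeter ℓ γ θ T)
    (heq : tracerRoll γ θ = length γ) {t : ℝ} (ht : t ∈ Icc (0 : ℝ) 1) :
    chisel ℓ γ θ t = chisel ℓ γ θ 0 := by
  classical
  have hNi := hγ.intervalIntegrable_inner (continuousOn_rodNormal h.continuousOn)
  have hle : ∀ t, (inner ℝ (rodNormal (θ t)) (deriv γ t) : ℝ) ≤ ‖deriv γ t‖ := fun t =>
    (real_inner_le_norm _ _).trans (by rw [norm_rodNormal, one_mul])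
  have hae : ∀ᵐ t ∂(volume.restrict (Ioc (0 : ℝ) 1)),
      ‖deriv γ t‖ - inner ℝ (rodNormal (θ t)) (deriv γ t) = 0 := by
    have h1 : ∫ t in (0 : ℝ)..1, (‖deriv γ t‖ - inner ℝ (rodNormal (θ t)) (deriv γ t)) = 0 := by
      rw [intervalIntegral.integral_sub hγ.intervalIntegrable_deriv.norm hNi]
      exact sub_eq_zero.2 heq.symm
    exact (intervalIntegral.integral_eq_zero_iff_of_le_of_nonneg_ae zero_le_one
      (.of_forall fun t => sub_nonneg.2 (hle t))
      (hγ.intervalIntegrable_deriv.norm.sub hNi)).1 h1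
  set p' : ℝ → ℂ := fun t =>
    deriv γ t - (ℓ * angularVelocity ℓ γ θ t : ℝ) * rodNormal (θ t) with hp'
  have hp0 : ∀ᵐ t ∂(volume.restrict (uIoc (0 : ℝ) 1)), p' t = 0 := by
    rw [uIoc_of_le zero_le_one]
    filter_upwards [hae] with t ht
    have h1 := (inner_eq_norm_mul_iff_real (x := rodNormal (θ t)) (y := deriv γ t)).1
      (by rw [norm_rodNormal, one_mul]; linarith)
    rw [norm_rodNormal, one_smul] at h1
    simp only [hp', mul_angularVelocity hℓ]
    rw [← sub_eq_zero.1 ht, ← Complex.real_smul, h1, sub_self]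
  have hpi : IntervalIntegrable p' volume 0 1 := by
    rw [intervalIntegrable_iff]
    exact (integrable_zero _ _ _).congr (hp0.mono fun t ht => ht.symm)
  have hcont : ContinuousOn (chisel ℓ γ θ) (Icc 0 1) := by
    refine hγ.continuousOn.add (continuousOn_const.mul ?_)
    exact ((Complex.continuous_ofReal.comp_continuousOn h.continuousOn).mul
      continuousOn_const).cexp
  have hsub := uIcc_subset_uIcc_zero_one (a := 0) (by simp) ht
  have h2 := integral_eq_of_hasDerivAt_off_countable_of_le (chisel ℓ γ θ) p' ht.1
    (S ∪ T).countable_toSet (hcont.mono (Icc_subset_Icc_right ht.2)) (fun u hu => by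
      have hu01 : u ∈ Ioo (0 : ℝ) 1 := ⟨hu.1.1, hu.1.2.trans_le ht.2⟩
      have hST := hu.2
      simp only [Finset.mem_coe, Finset.mem_union, not_or] at hST
      exact hasDerivAt_chisel (hγ.hasDerivAt hu01 hST.1) (h.hasDerivAt u hu01 hST.2))
    (hpi.mono_set hsub)
  rw [← sub_eq_zero, ← h2, intervalIntegral.integral_zero_ae]
  rw [uIoc_of_le zero_le_one, ae_restrict_iff' measurableSet_Ioc] at hp0
  filter_upwards [hp0] with u hu hut
  rw [uIoc_of_le ht.1] at hut
  exact hu ⟨hut.1, hut.2.trans ht.2⟩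

/-- A rod that makes a full rotation about a fixed chisel point traces a whole circle. -/
theorem image_eq_sphere (hℓ : 0 < ℓ) (hθ : ContinuousOn θ (Icc 0 1))
    (hrot : θ 1 - θ 0 = 2 * Real.pi) {z : ℂ} (hz : ∀ t ∈ Icc (0 : ℝ) 1, chisel ℓ γ θ t = z) :
    γ '' Icc 0 1 = Metric.sphere z ℓ := by
  have hγz : ∀ t ∈ Icc (0 : ℝ) 1, γ t = z - ℓ * Complex.exp (θ t * Complex.I) := fun t ht => by
    rw [← hz t ht, chisel, add_sub_cancel_right]
  apply Subset.antisymm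
  · rintro _ ⟨t, ht, rfl⟩
    rw [mem_sphere_iff_norm, hγz t ht, sub_sub_cancel_left, norm_neg, norm_mul,
      Complex.norm_exp_ofReal_mul_I, mul_one, Complex.norm_real, Real.norm_of_nonneg hℓ.le]
  · intro w hw
    obtain ⟨k, hk, -⟩ := existsUnique_add_zsmul_mem_Ico Real.two_pi_pos (z - w).arg (θ 0)
    have hmem : (z - w).arg + k • (2 * Real.pi) ∈ Icc (θ 0) (θ 1) :=
      ⟨hk.1, by linarith [hk.2]⟩
    obtain ⟨t, ht, he⟩ := intermediate_value_Icc zero_le_one hθ hmem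
    refine ⟨t, ht, ?_⟩
    have hnorm : ‖z - w‖ = ℓ := by
      rw [← norm_neg, neg_sub]
      exact mem_sphere_iff_norm.1 hw
    have hexp : Complex.exp (θ t * Complex.I) = Complex.exp ((z - w).arg * Complex.I) := by
      rw [he]
      refine Complex.exp_eq_exp_iff_exists_int.2 ⟨k, ?_⟩
      simp
      ring
    rw [hγz t ht, hexp, ← hnorm, Complex.norm_mul_exp_arg_mul_I]
    ring

end

/-! ### The isoperimetric inequality -/

section

variable {Ω : Set ℂ} {γ : ℝ → ℂ} {ℓ : ℝ} {θ : ℝ → ℝ}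

theorem IsClosedTractrixOneRotation.tracerRoll_eq (hΩ : IsRegion Ω γ) (hℓ : 0 < ℓ)
    (h : IsClosedTractrixOneRotation ℓ γ θ) : tracerRoll γ θ = 2 * Real.pi * ℓ := by
  obtain ⟨S, C, hγ⟩ := hΩ.piecewiseC1.exists_isTame
  obtain ⟨T, hT⟩ := h.1.exists_solves hℓ
  rw [Planimeter.tracerRoll_eq hℓ hγ hT, h.2.2]
  ring

theorem IsClosedTractrixOneRotation.orientedArea_chisel (hΩ : IsRegion Ω γ) (hℓ : 0 < ℓ)
    (h : IsClosedTractrixOneRotation ℓ γ θ) :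
    orientedArea (chisel ℓ γ θ) = area Ω - Real.pi * ℓ ^ 2 := by
  obtain ⟨S, C, hγ⟩ := hΩ.piecewiseC1.exists_isTame
  obtain ⟨T, hT⟩ := h.1.exists_solves hℓ
  rw [hΩ.area_eq hγ, orientedArea_chisel_eq hℓ hγ hT hΩ.closed h.2.2, h.tracerRoll_eq hΩ hℓ]
  ring

theorem IsClosedTractrixOneRotation.sweptArea_eq (hΩ : IsRegion Ω γ) (hℓ : 0 < ℓ)
    (h : IsClosedTractrixOneRotation ℓ γ θ) : sweptArea ℓ γ θ = Real.pi * ℓ ^ 2 := by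
  obtain ⟨S, C, hγ⟩ := hΩ.piecewiseC1.exists_isTame
  obtain ⟨T, hT⟩ := h.1.exists_solves hℓ
  rw [Planimeter.sweptArea_eq hℓ hγ hT, h.tracerRoll_eq hΩ hℓ]
  ring

theorem IsClosedTractrixOneRotation.tracerRoll_le (hΩ : IsRegion Ω γ)
    (h : IsClosedTractrixOneRotation ℓ γ θ) : tracerRoll γ θ ≤ length γ := by
  obtain ⟨S, C, hγ⟩ := hΩ.piecewiseC1.exists_isTame
  exact tracerRoll_le_length hγ h.1.1

theorem IsClosedTractrixOneRotation.tracerRoll_sq (hΩ : IsRegion Ω γ) (hℓ : 0 < ℓ)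
    (hA : area Ω = Real.pi * ℓ ^ 2) (h : IsClosedTractrixOneRotation ℓ γ θ) :
    tracerRoll γ θ ^ 2 = 4 * Real.pi * area Ω := by
  rw [h.tracerRoll_eq hΩ hℓ, hA]
  ring

theorem MenzinFor.exists_limit_tractrix (hΩ : IsRegion Ω γ) (hM : MenzinFor Ω γ) :
    ∃ ℓ > 0, area Ω = Real.pi * ℓ ^ 2 ∧ ∃ θ, IsClosedTractrixOneRotation ℓ γ θ := by
  obtain ⟨S, C, hγ⟩ := hΩ.piecewiseC1.exists_isTame
  have hpos : 0 < area Ω / Real.pi := div_pos hΩ.area_pos Real.pi_pos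
  have hA : area Ω = Real.pi * Real.sqrt (area Ω / Real.pi) ^ 2 := by
    rw [Real.sq_sqrt hpos.le, mul_div_cancel₀ _ Real.pi_pos.ne']
  exact ⟨_, Real.sqrt_pos.2 hpos, hA,
    hM.exists_of_area_eq hγ hΩ.closed (Real.sqrt_pos.2 hpos) hA⟩

theorem MenzinFor.isoperimetric (hΩ : IsRegion Ω γ) (hM : MenzinFor Ω γ) :
    4 * Real.pi * area Ω ≤ length γ ^ 2 := by
  obtain ⟨ℓ, hℓ, hA, θ, h⟩ := hM.exists_limit_tractrix hΩ
  have h0 : 0 ≤ tracerRoll γ θ := by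
    rw [h.tracerRoll_eq hΩ hℓ]
    positivity
  rw [← h.tracerRoll_sq hΩ hℓ hA]
  exact pow_le_pow_left₀ h0 (h.tracerRoll_le hΩ) 2

theorem MenzinFor.isoperimetric_equality (hΩ : IsRegion Ω γ) (hM : MenzinFor Ω γ)
    (heq : length γ ^ 2 = 4 * Real.pi * area Ω) :
    ∃ (z : ℂ) (r : ℝ), 0 < r ∧ frontier Ω = Metric.sphere z r := by
  obtain ⟨S, C, hγ⟩ := hΩ.piecewiseC1.exists_isTame
  obtain ⟨ℓ, hℓ, hA, θ, h⟩ := hM.exists_limit_tractrix hΩ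
  have h0 : 0 ≤ tracerRoll γ θ := by
    rw [h.tracerRoll_eq hΩ hℓ]
    positivity
  have hroll : tracerRoll γ θ = length γ :=
    (sq_eq_sq₀ h0 (h0.trans (h.tracerRoll_le hΩ))).1
      ((h.tracerRoll_sq hΩ hℓ hA).trans heq.symm)
  obtain ⟨T, hT⟩ := h.1.exists_solves hℓ
  refine ⟨chisel ℓ γ θ 0, ℓ, hℓ, ?_⟩
  rw [hΩ.frontier_eq]
  exact image_eq_sphere hℓ h.1.1 h.2.2 fun t ht => hT.chisel_eq hℓ hγ hroll ht

end

end Planimeter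

theorem mainTheorem4 :
    -- the area-sweeping identities along a closed tractrix with one full rotation, and `σ_T ≤ L`
    (∀ (Ω : Set ℂ) (γ : ℝ → ℂ), Planimeter.IsRegion Ω γ →
      ∀ (ℓ : ℝ) (θ : ℝ → ℝ), 0 < ℓ → Planimeter.IsClosedTractrixOneRotation ℓ γ θ →
        Planimeter.sweptArea ℓ γ θ = Real.pi * ℓ ^ 2 ∧
        Planimeter.sweptArea ℓ γ θ =
          Planimeter.area Ω - Planimeter.orientedArea (Planimeter.chisel ℓ γ θ) ∧
        Planimeter.sweptArea ℓ γ θ = ℓ * Planimeter.tracerRoll γ θ - Real.pi * ℓ ^ 2 ∧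
        Planimeter.tracerRoll γ θ ≤ Planimeter.length γ) ∧
    -- region by region, Menzin's conjecture gives the limiting case and the isoperimetric inequality
    (∀ (Ω : Set ℂ) (γ : ℝ → ℂ), Planimeter.IsRegion Ω γ → Planimeter.MenzinFor Ω γ →
      (∀ ℓ : ℝ, 0 < ℓ → Planimeter.area Ω = Real.pi * ℓ ^ 2 →
        (∃ θ : ℝ → ℝ, Planimeter.IsClosedTractrixOneRotation ℓ γ θ) ∧
        ∀ θ : ℝ → ℝ, Planimeter.IsClosedTractrixOneRotation ℓ γ θ →
          Planimeter.orientedArea (Planimeter.chisel ℓ γ θ) = 0 ∧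
          Planimeter.tracerRoll γ θ ^ 2 = 4 * Real.pi * Planimeter.area Ω) ∧
      4 * Real.pi * Planimeter.area Ω ≤ Planimeter.length γ ^ 2 ∧
      (Planimeter.length γ ^ 2 = 4 * Real.pi * Planimeter.area Ω →
        ∃ (z : ℂ) (r : ℝ), 0 < r ∧ frontier Ω = Metric.sphere z r)) ∧
    -- hence Menzin's conjecture implies the isoperimetric inequality for all regions
    (Planimeter.MenzinConjecture →
      ∀ (Ω : Set ℂ) (γ : ℝ → ℂ), Planimeter.IsRegion Ω γ →
        4 * Real.pi * Planimeter.area Ω ≤ Planimeter.length γ ^ 2 ∧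
        (Planimeter.length γ ^ 2 = 4 * Real.pi * Planimeter.area Ω →
          ∃ (z : ℂ) (r : ℝ), 0 < r ∧ frontier Ω = Metric.sphere z r)) := by
  refine ⟨fun Ω γ hΩ ℓ θ hℓ h => ?_, fun Ω γ hΩ hM => ⟨fun ℓ hℓ hA => ⟨?_, fun θ h => ⟨?_, ?_⟩⟩,
    hM.isoperimetric hΩ, hM.isoperimetric_equality hΩ⟩, fun hM Ω γ hΩ =>
    ⟨(hM Ω γ hΩ).isoperimetric hΩ, (hM Ω γ hΩ).isoperimetric_equality hΩ⟩⟩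
  · refine ⟨h.sweptArea_eq hΩ hℓ, ?_, ?_, h.tracerRoll_le hΩ⟩
    · rw [h.sweptArea_eq hΩ hℓ, h.orientedArea_chisel hΩ hℓ]
      ring
    · rw [h.sweptArea_eq hΩ hℓ, h.tracerRoll_eq hΩ hℓ]
      ring
  · obtain ⟨S, C, hγ⟩ := hΩ.piecewiseC1.exists_isTame
    exact hM.exists_of_area_eq hγ hΩ.closed hℓ hA
  · rw [h.orientedArea_chisel hΩ hℓ, hA, sub_self]
  · exact h.tracerRoll_sq hΩ hℓ hA
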